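/- Let $K$ be a nonzero commutative $\mathbb Q$-algebra with a derivation $\partial$ (the coefficients, e.g. functions of $x$ with $\partial=d/dx$), and let $\lambda\in K$ be a constant, $\partial\lambda=0$. For a family of variables $q=(q_i)$ one works in the commutative differential ring over $K$ generated by the independent jets $q_i^{(j)}=\partial^j q_i$, $j\ge 0$, with one of the variables inverted. Let $$\mathcal C=K[A_n^{(j)},\varphi^{(j)}: n,j\ge 0][A_0^{-1}],\qquad \mathcal C'=K[u^{(j)},h^{(j)},\varphi^{(j)}: j\ge 0][h^{-1}].$$ Put $\delta H/\delta q_i=\sum_{j\ge0}(-\partial)^j(\partial H/\partial q_i^{(j)})$. A matrix $B=(B_{im})$ of differential operators assigns to each element $H$ the evolution vector field $X_H$, i.e. the derivation over $K$ with $X_H(q_i^{(j)})=\partial^j\big(\sum_m B_{im}(\delta H/\delta q_m)\big)$. $H$ is a Casimir of $B$ if $X_H=0$. A homomorphism $\Phi$ of $K$-algebras is a Hamiltonian map from $B_1$ to $B_2$ if $\Phi\partial=\partial\Phi$ and $\Phi X_H=X_{\Phi(H)}\Phi$ for all $H$; it is a Hamiltonian automorphism of $B$ if it is bijective and a Hamiltonian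 map from $B$ to $B$. Put $Q_n(w)=(\partial+w)^n(1)$, and write $\varphi_x=\partial\varphi$; in the matrices below, products are compositions of operators. **Extended KP matrix.** On $\mathcal C$ let, for $n,m\ge 0$, $$\bar{\mathcal B}_{nm}=\sum_{\mu\ge0}\Big[\tbinom n\mu A_{n+m-\mu}\partial^\mu-(-\partial)^\mu\tbinom m\mu A_{n+m-\mu}\Big],\quad \bar{\mathcal B}_{\varphi m}=\frac{\varphi_x}{A_0}\sum_{s\ge0}(-\partial)^s\tbinom m{s+1}A_{m-1-s},$$ $$\bar{\mathcal B}_{n\varphi}=-\sum_{s\ge0}\tbinom n{s+1}A_{n-1-s}\partial^s\frac{\varphi_x}{A_0},\qquad \bar{\mathcal B}_{\varphi\varphi}=0 .$$ On $\mathcal C'$ let $B$ be the matrix with $B_{uh}=B_{hu}=\partial$, $B_{\varphi u}=\varphi_x/h=-B_{u\varphi}$ and all other entries zero. Then: (i) The differential $K$-homomorphism $\Phi:\mathcal C\to\mathcal C$ with $\Phi(A_n)=\sum_{k=0}^n\binom nk A_kQ_{n-k}(\lambda\varphi)$ and $\Phi(\varphi)=\varphi$ is a Hamiltonian automorphism of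 $\bar{\mathcal B}$. (ii) $A_0$ and $A_0\varphi^2$ are Casimirs of $\bar{\mathcal B}$, and the second is new: $A_0\varphi^2\ne aA_0+\partial g$ for all $a\in K$, $g\in\mathcal C$. (iii) Let $R:\mathcal C\to\mathcal C'$ be the differential $K$-homomorphism with $R(A_n)=hQ_n(u)$, $R(\varphi)=\varphi$, and $\Psi:\mathcal C'\to\mathcal C'$ the one with $\Psi(u)=u+\lambda\varphi$, $\Psi(h)=h$, $\Psi(\varphi)=\varphi$. Then $R$ is surjective and a Hamiltonian map from $\bar{\mathcal B}$ to $B$ (a Hamiltonian embedding of the $(u,h,\varphi)$-space), $\Psi$ is a Hamiltonian automorphism of $B$, and $\Phi$ covers $\Psi$: $R\circ\Phi=\Psi\circ R$. Moreover, for $U\in\mathcal C'$, one has $R(\Phi(A_n))=hQ_n(U)$ for all $n\ge0$ if and only if $U=u+\lambda\varphi$. **Dispersionless version.** The statements (i)–(iii) also hold for the extended Benney matrix on $\mathcal C$, $$\mathcal B_{nm}=nA_{n+m-1}\partial+\partial\,mA_{n+m-1},\quad \mathcal B_{\varphi m}=\varphi_x\,mA_{m-1}/A_0,\quad \mathcal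 B_{n\varphi}=-\varphi_x\,nA_{n-1}/A_0,\quad \mathcal B_{\varphi\varphi}=0$$ (terms with coefficient $0$ being omitted), with $\Phi(A_n)=\sum_{k=0}^n\binom nkA_k(\lambda\varphi)^{n-k}$ in (i), and with $R(A_n)=hu^n$ and $R(\Phi(A_n))=hU^n$ in (iii); $B$ and $\Psi$ are unchanged. -/

import Mathlib

open Finset

namespace KPExt

noncomputable section

/-! ### Differential rings of the variables of an infinite jet space

`K` is a differential ring of coefficients (functions of `x`), `ι` labels the dependent variables,
and `i₀ : ι` labels the one that is allowed in denominators. -/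

/-- `K[q_i^{(j)} : i ∈ ι, j ≥ 0][1 / q_{i₀}]`; the index `(i, j)` stands for `q_i^{(j)}`. -/
def JetRing (K : Type*) [CommRing K] {ι : Type} (i₀ : ι) : Type _ :=
  Localization.Away (MvPolynomial.X (i₀, 0) : MvPolynomial (ι × ℕ) K)

section JetRing

variable {K : Type*} [CommRing K] {ι : Type} {i₀ : ι}

instance : CommRing (JetRing K i₀) :=
  inferInstanceAs (CommRing (Localization.Away (MvPolynomial.X (i₀, 0) : MvPolynomial (ι × ℕ) K)))

instance : Algebra (MvPolynomial (ι × ℕ) K) (JetRing K i₀) :=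
  inferInstanceAs (Algebra (MvPolynomial (ι × ℕ) K)
    (Localization.Away (MvPolynomial.X (i₀, 0) : MvPolynomial (ι × ℕ) K)))

instance : Algebra K (JetRing K i₀) :=
  inferInstanceAs (Algebra K (Localization.Away (MvPolynomial.X (i₀, 0) : MvPolynomial (ι × ℕ) K)))

instance : IsScalarTower K (MvPolynomial (ι × ℕ) K) (JetRing K i₀) :=
  inferInstanceAs (IsScalarTower K (MvPolynomial (ι × ℕ) K)
    (Localization.Away (MvPolynomial.X (i₀, 0) : MvPolynomial (ι × ℕ) K)))

instance : IsLocalization.Away (MvPolynomial.X (i₀, 0) : MvPolynomial (ι × ℕ) K) (JetRing K i₀) :=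
  inferInstanceAs (IsLocalization.Away (MvPolynomial.X (i₀, 0) : MvPolynomial (ι × ℕ) K)
    (Localization.Away (MvPolynomial.X (i₀, 0) : MvPolynomial (ι × ℕ) K)))

/-- The variable `q_i^{(j)}`. -/
def jet (i : ι) (j : ℕ) : JetRing K i₀ :=
  algebraMap (MvPolynomial (ι × ℕ) K) (JetRing K i₀) (MvPolynomial.X (i, j))

/-- The variable `q_i = q_i^{(0)}`. -/
def var (i : ι) : JetRing K i₀ := jet i 0

/-- The element `1 / q_{i₀}`. -/
def varInv : JetRing K i₀ :=
  IsLocalization.Away.invSelf (MvPolynomial.X (i₀, 0) : MvPolynomial (ι × ℕ) K)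

theorem var_mul_varInv : (var i₀ : JetRing K i₀) * varInv = 1 :=
  IsLocalization.Away.mul_invSelf (MvPolynomial.X (i₀, 0) : MvPolynomial (ι × ℕ) K)

theorem isUnit_var : IsUnit (var i₀ : JetRing K i₀) :=
  IsUnit.of_mul_eq_one _ var_mul_varInv

/-- The ring homomorphism `f ↦ f + ε D(f)` into the dual numbers, for the derivation `D` that is
`d` on the coefficients and takes the value `g (i, j)` at `q_i^{(j)}`. -/
def derivHom (d : Derivation ℤ K K) (g : ι × ℕ → JetRing K i₀) :
    JetRing K i₀ →+* DualNumber (JetRing K i₀) :=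
  IsLocalization.Away.lift (MvPolynomial.X (i₀, 0) : MvPolynomial (ι × ℕ) K)
    (g := MvPolynomial.eval₂Hom
      { toFun := fun c => TrivSqZeroExt.inl (algebraMap K (JetRing K i₀) c) +
          TrivSqZeroExt.inr (algebraMap K (JetRing K i₀) (d c))
        map_one' := by ext <;> simp
        map_zero' := by ext <;> simp
        map_add' := fun a b => by ext <;> simp only [map_add, TrivSqZeroExt.fst_add,
          TrivSqZeroExt.snd_add, TrivSqZeroExt.fst_inl, TrivSqZeroExt.snd_inl,
          TrivSqZeroExt.fst_inr, TrivSqZeroExt.snd_inr] <;> ring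
        map_mul' := fun a b => by
          ext <;> simp only [map_add, map_mul, Derivation.leibniz, smul_eq_mul,
            TrivSqZeroExt.fst_add, TrivSqZeroExt.snd_add, TrivSqZeroExt.fst_inl,
            TrivSqZeroExt.snd_inl, TrivSqZeroExt.fst_inr, TrivSqZeroExt.snd_inr,
            TrivSqZeroExt.fst_mul, TrivSqZeroExt.snd_mul, MulOpposite.smul_eq_mul_unop,
            MulOpposite.unop_op] <;> ring }
      (fun w : ι × ℕ => TrivSqZeroExt.inl (jet w.1 w.2) + TrivSqZeroExt.inr (g w)))
    (by
      rw [TrivSqZeroExt.isUnit_iff_isUnit_fst]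
      have := isUnit_var (K := K) (i₀ := i₀)
      rw [var] at this
      simpa using this)

theorem derivHom_jet (d : Derivation ℤ K K) (g : ι × ℕ → JetRing K i₀) (i : ι) (j : ℕ) :
    derivHom d g (jet i j) = TrivSqZeroExt.inl (jet i j) + TrivSqZeroExt.inr (g (i, j)) := by
  rw [derivHom, jet, IsLocalization.Away.lift_eq]
  simp [jet]

theorem derivHom_algebraMap (d : Derivation ℤ K K) (g : ι × ℕ → JetRing K i₀) (c : K) :
    derivHom d g (algebraMap K (JetRing K i₀) c) =
      TrivSqZeroExt.inl (algebraMap K (JetRing K i₀) c) +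
        TrivSqZeroExt.inr (algebraMap K (JetRing K i₀) (d c)) := by
  rw [IsScalarTower.algebraMap_apply K (MvPolynomial (ι × ℕ) K) (JetRing K i₀) c]
  rw [derivHom, IsLocalization.Away.lift_eq, ← IsScalarTower.algebraMap_apply]
  simp only [MvPolynomial.algebraMap_eq, MvPolynomial.coe_eval₂Hom, MvPolynomial.eval₂_C]
  rfl

/-- Two ring homomorphisms out of the jet ring agree if they agree on `K` and on all
variables. -/
theorem jetRing_hom_ext {S : Type*} [CommRing S] {f g : JetRing K i₀ →+* S}
    (hK : ∀ c : K, f (algebraMap K _ c) = g (algebraMap K _ c))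
    (hjet : ∀ i j, f (jet i j) = g (jet i j)) : f = g := by
  apply IsLocalization.ringHom_ext (Submonoid.powers (MvPolynomial.X (i₀, 0) : MvPolynomial (ι × ℕ) K))
  apply MvPolynomial.ringHom_ext
  · intro c
    exact hK c
  · rintro ⟨i, j⟩
    exact hjet i j

theorem derivHom_fst (d : Derivation ℤ K K) (g : ι × ℕ → JetRing K i₀) (f : JetRing K i₀) :
    (derivHom d g f).fst = f := by
  have h : (TrivSqZeroExt.fstHom (JetRing K i₀) (JetRing K i₀) (JetRing K i₀)).toRingHom.comp
      (derivHom d g) = RingHom.id _ := by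
    apply jetRing_hom_ext
    · intro c
      simp [derivHom_algebraMap]
    · intro i j
      simp [derivHom_jet]
  exact congrArg (fun φ : JetRing K i₀ →+* JetRing K i₀ => φ f) h

/-- The derivation of the jet ring that is `d` on the coefficients and takes the value
`g (i, j)` at `q_i^{(j)}`. -/
def derivExt (d : Derivation ℤ K K) (g : ι × ℕ → JetRing K i₀) :
    Derivation ℤ (JetRing K i₀) (JetRing K i₀) :=
  Derivation.mk'
    (AddMonoidHom.toIntLinearMap
      { toFun := fun f => (derivHom d g f).snd
        map_zero' := by simp
        map_add' := fun a b => by simp })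
    (fun a b => by simp [derivHom_fst, mul_comm b])

theorem derivExt_apply (d : Derivation ℤ K K) (g : ι × ℕ → JetRing K i₀) (f : JetRing K i₀) :
    derivExt d g f = (derivHom d g f).snd := rfl

theorem derivExt_jet (d : Derivation ℤ K K) (g : ι × ℕ → JetRing K i₀) (i : ι) (j : ℕ) :
    derivExt d g (jet i j) = g (i, j) := by
  simp [derivExt_apply, derivHom_jet]

theorem derivExt_algebraMap (d : Derivation ℤ K K) (g : ι × ℕ → JetRing K i₀) (c : K) :
    derivExt d g (algebraMap K _ c) = algebraMap K _ (d c) := by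
  rw [derivExt_apply, derivHom_algebraMap, TrivSqZeroExt.snd_add, TrivSqZeroExt.snd_inl,
    TrivSqZeroExt.snd_inr, zero_add]

open Classical in
/-- The partial derivative `∂ / ∂q_i^{(j)}`, with `w = (i, j)`. -/
def partialD (w : ι × ℕ) : Derivation ℤ (JetRing K i₀) (JetRing K i₀) :=
  derivExt 0 (fun w' => if w' = w then 1 else 0)

open Classical in
theorem partialD_jet (w : ι × ℕ) (i : ι) (j : ℕ) :
    partialD w (jet i j : JetRing K i₀) = if (i, j) = w then 1 else 0 :=
  derivExt_jet 0 _ i j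

theorem partialD_algebraMap (w : ι × ℕ) (c : K) :
    partialD w (algebraMap K (JetRing K i₀) c) = 0 :=
  (derivExt_algebraMap 0 _ c).trans (map_zero _)

theorem partialD_support_finite (f : JetRing K i₀) : {w | partialD w f ≠ 0}.Finite := by
  have hpoly : ∀ p : MvPolynomial (ι × ℕ) K,
      {w | partialD w (algebraMap _ (JetRing K i₀) p) ≠ 0}.Finite := by
    intro p
    induction p using MvPolynomial.induction_on with
    | C c =>
      convert Set.finite_empty
      ext w
      have : algebraMap (MvPolynomial (ι × ℕ) K) (JetRing K i₀) (MvPolynomial.C c) =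
          algebraMap K _ c :=
        (IsScalarTower.algebraMap_apply K (MvPolynomial (ι × ℕ) K) (JetRing K i₀) c).symm
      simp [this, partialD_algebraMap]
    | add p q hp hq =>
      refine (hp.union hq).subset fun w hw => ?_
      by_contra h
      simp only [Set.mem_union, Set.mem_ofPred_eq, not_or, not_not] at h
      exact hw (by simp [h.1, h.2])
    | mul_X p v hp =>
      refine (hp.union (Set.finite_singleton v)).subset fun w hw => ?_
      by_contra h
      simp only [Set.mem_union, Set.mem_ofPred_eq, not_or, not_not, Set.mem_singleton_iff] at h
      have hv : partialD w (jet v.1 v.2 : JetRing K i₀) = 0 := by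
        rw [partialD_jet, if_neg (fun h' => h.2 h'.symm)]
      refine hw ?_
      rw [map_mul, Derivation.leibniz, h.1, smul_zero, add_zero]
      exact (congrArg _ hv).trans (smul_zero _)
  obtain ⟨⟨p, s⟩, hps⟩ := IsLocalization.surj
    (Submonoid.powers (MvPolynomial.X (i₀, 0) : MvPolynomial (ι × ℕ) K)) f
  refine ((hpoly p).union (hpoly s)).subset fun w hw => ?_
  by_contra h
  simp only [Set.mem_union, Set.mem_ofPred_eq, not_or, not_not] at h
  apply hw
  have h1 := congrArg (partialD w) hps
  rw [Derivation.leibniz, h.1, h.2, smul_zero, zero_add, smul_eq_mul] at h1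
  exact (IsLocalization.map_units (JetRing K i₀) s).mul_right_eq_zero.mp h1

/-- The `K`-algebra homomorphism with `q_i^{(j)} ↦ G (i, j)`. -/
def algHomExt {S : Type*} [CommRing S] [Algebra K S] (G : ι × ℕ → S) (hG : IsUnit (G (i₀, 0))) :
    JetRing K i₀ →ₐ[K] S :=
  { IsLocalization.Away.lift (S := JetRing K i₀) (MvPolynomial.X (i₀, 0) : MvPolynomial (ι × ℕ) K)
      (g := (MvPolynomial.aeval G : MvPolynomial (ι × ℕ) K →ₐ[K] S).toRingHom)
      (by simpa using hG) with
    commutes' := fun c => by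
      rw [IsScalarTower.algebraMap_apply K (MvPolynomial (ι × ℕ) K) (JetRing K i₀) c]
      refine (IsLocalization.Away.lift_eq _ _ _).trans ?_
      exact (MvPolynomial.aeval G).commutes c }

theorem algHomExt_jet {S : Type*} [CommRing S] [Algebra K S] (G : ι × ℕ → S)
    (hG : IsUnit (G (i₀, 0))) (i : ι) (j : ℕ) :
    (algHomExt G hG : JetRing K i₀ →ₐ[K] S) (jet i j) = G (i, j) := by
  refine (IsLocalization.Away.lift_eq (S := JetRing K i₀)
    (MvPolynomial.X (i₀, 0) : MvPolynomial (ι × ℕ) K)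
    (g := (MvPolynomial.aeval G : MvPolynomial (ι × ℕ) K →ₐ[K] S).toRingHom)
    (by simpa using hG) _).trans ?_
  simp

variable [Differential K]

/-- The total derivative `∂ = d/dx`: the given derivation on `K`, and
`∂ q_i^{(j)} = q_i^{(j+1)}`. -/
def totalD : Derivation ℤ (JetRing K i₀) (JetRing K i₀) :=
  derivExt Differential.deriv (fun w => jet w.1 (w.2 + 1))

/-- `∂` as an operator on the jet ring. -/
def del : Module.End ℤ (JetRing K i₀) :=
  (totalD : Derivation ℤ (JetRing K i₀) (JetRing K i₀)).toLinearMap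

/-- The operator of multiplication by `a`. -/
def mulOp (a : JetRing K i₀) : Module.End ℤ (JetRing K i₀) := LinearMap.mulLeft ℤ a

/-- The variational derivative `δH/δq_i = ∑_j (-∂)^j (∂H/∂q_i^{(j)})`. -/
def varDeriv (i : ι) (H : JetRing K i₀) : JetRing K i₀ :=
  ∑ᶠ j : ℕ, ((-del) ^ j : Module.End ℤ (JetRing K i₀)) (partialD (i, j) H)

/-- The sums defining `varDeriv` (above) and `hamRHS` (below) are finite. -/
theorem varDeriv_support_finite (H : JetRing K i₀) :
    (∀ i, {j | ((-del) ^ j : Module.End ℤ (JetRing K i₀)) (partialD (i, j) H) ≠ 0}.Finite) ∧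
      {i | varDeriv i H ≠ 0}.Finite := by
  constructor
  · intro i
    refine ((partialD_support_finite H).preimage (f := fun j : ℕ => (i, j))
      (fun a _ b _ h => (Prod.mk.inj h).2)).subset fun j hj h => hj ?_
    rw [h, map_zero]
  · refine ((partialD_support_finite H).image Prod.fst).subset fun i hi => ?_
    by_contra h
    refine hi (finsum_eq_zero_of_forall_eq_zero fun j => ?_)
    have : partialD (i, j) H = 0 := by
      by_contra h'
      exact h ⟨(i, j), h', rfl⟩
    rw [this, map_zero]

/-- The evolution vector field `X` with motion equations `q_{i,t} = Z i`: the derivation over `K`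
with `X(q_i^{(j)}) = ∂^j (Z i)`. -/
def evolution (Z : ι → JetRing K i₀) : Derivation ℤ (JetRing K i₀) (JetRing K i₀) :=
  derivExt 0 (fun w => (del ^ w.2) (Z w.1))

/-- The right hand sides `∑_m B_{im} (δH/δq_m)` of the motion equations with Hamiltonian `H`. -/
def hamRHS (B : ι → ι → Module.End ℤ (JetRing K i₀)) (H : JetRing K i₀) (i : ι) : JetRing K i₀ :=
  ∑ᶠ m : ι, B i m (varDeriv m H)

/-- The Hamiltonian vector field `X_H` of the matrix `B`. -/
def hamField (B : ι → ι → Module.End ℤ (JetRing K i₀)) (H : JetRing K i₀) :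
    Derivation ℤ (JetRing K i₀) (JetRing K i₀) :=
  evolution (hamRHS B H)

/-- `H` is a Casimir of the matrix `B`: `X_H = 0`. -/
def IsCasimir (B : ι → ι → Module.End ℤ (JetRing K i₀)) (H : JetRing K i₀) : Prop :=
  hamField B H = 0

/-- The homomorphism of differential `K`-algebras with `q_i ↦ g i`, so `q_i^{(j)} ↦ ∂^j (g i)`. -/
def diffHom {κ : Type} {k₀ : κ} (g : ι → JetRing K k₀) (hg : IsUnit (g i₀)) :
    JetRing K i₀ →ₐ[K] JetRing K k₀ :=
  algHomExt (fun w => (del ^ w.2) (g w.1)) (by simpa using hg)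

theorem diffHom_var {κ : Type} {k₀ : κ} (g : ι → JetRing K k₀) (hg : IsUnit (g i₀)) (i : ι) :
    (diffHom g hg : JetRing K i₀ →ₐ[K] JetRing K k₀) (var i) = g i := by
  simp [diffHom, var, algHomExt_jet]

/-- `Φ` is a Hamiltonian map from the matrix `B₁` to the matrix `B₂`: a differential homomorphism
with `Φ X_H = X_{Φ(H)} Φ` for every Hamiltonian `H`. -/
structure IsHamiltonianMap {κ : Type} {k₀ : κ} (B₁ : ι → ι → Module.End ℤ (JetRing K i₀))
    (B₂ : κ → κ → Module.End ℤ (JetRing K k₀)) (Φ : JetRing K i₀ →ₐ[K] JetRing K k₀) : Prop where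
  map_totalD : ∀ f, Φ (totalD f) = totalD (Φ f)
  map_hamField : ∀ H f, Φ (hamField B₁ H f) = hamField B₂ (Φ H) (Φ f)

/-- `Φ` is a Hamiltonian automorphism of the matrix `B`. -/
structure IsHamiltonianAut (B : ι → ι → Module.End ℤ (JetRing K i₀))
    (Φ : JetRing K i₀ →ₐ[K] JetRing K i₀) : Prop where
  bijective : Function.Bijective Φ
  isHamiltonianMap : IsHamiltonianMap B B Φ

/-- `Q_n(w) = (∂ + w)^n (1)`. -/
def Q (n : ℕ) (w : JetRing K i₀) : JetRing K i₀ :=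
  ((del + mulOp w) ^ n : Module.End ℤ (JetRing K i₀)) 1

end JetRing

/-! ### The moments space and the `(u, h, φ)`-space -/

/-- Labels of the variables `A_0, A_1, …` and `φ`. -/
inductive MomentIdx : Type
  | A (n : ℕ)
  | phi

/-- Labels of the variables `u`, `h`, `φ`. -/
inductive WaveIdx : Type
  | u
  | h
  | phi

/-- The differential ring in `A_0, A_1, …` and `φ`, with `1 / A_0`. -/
abbrev MomentRing (K : Type*) [CommRing K] : Type _ := JetRing K (MomentIdx.A 0)

/-- The differential ring in `u`, `h` and `φ`, with `1 / h`. -/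
abbrev WaveRing (K : Type*) [CommRing K] : Type _ := JetRing K WaveIdx.h

section Matrices

variable {K : Type*} [CommRing K]

/-- `A_n`. -/
def A (n : ℕ) : MomentRing K := var (MomentIdx.A n)

/-- `φ` in the moments space. -/
def phi : MomentRing K := var MomentIdx.phi

/-- `u`. -/
def wu : WaveRing K := var WaveIdx.u

/-- `h`. -/
def wh : WaveRing K := var WaveIdx.h

/-- `φ` in the `(u, h, φ)`-space. -/
def wphi : WaveRing K := var WaveIdx.phi

variable [Differential K]

/-- The extended KP matrix (for `α = 0`). The summation ranges contain all nonzero terms. -/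
def kpMatrix : MomentIdx → MomentIdx → Module.End ℤ (MomentRing K)
  | .A n, .A m => ∑ μ ∈ range (n + m + 1),
      (n.choose μ • (mulOp (A (n + m - μ)) * del ^ μ) -
        m.choose μ • ((-del) ^ μ * mulOp (A (n + m - μ))))
  | .phi, .A m => mulOp (varInv * totalD phi) *
      ∑ s ∈ range m, m.choose (s + 1) • ((-del) ^ s * mulOp (A (m - 1 - s)))
  | .A n, .phi => -((∑ s ∈ range n, n.choose (s + 1) • (mulOp (A (n - 1 - s)) * del ^ s)) *
      mulOp (varInv * totalD phi))
  | .phi, .phi => 0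

/-- The extended Benney matrix (for `α = 0`). For `n = 0` (resp. `m = 0`) the terms with the
factor `n` (resp. `m`) vanish. -/
def benneyMatrix : MomentIdx → MomentIdx → Module.End ℤ (MomentRing K)
  | .A n, .A m => n • (mulOp (A (n + m - 1)) * del) + m • (del * mulOp (A (n + m - 1)))
  | .phi, .A m => m • mulOp (totalD phi * A (m - 1) * varInv)
  | .A n, .phi => -(n • mulOp (totalD phi * A (n - 1) * varInv))
  | .phi, .phi => 0

/-- The extended matrix of the `(u, h, φ)`-space (for `α = 0`). -/
def waveMatrix : WaveIdx → WaveIdx → Module.End ℤ (WaveRing K)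
  | .u, .h => del
  | .h, .u => del
  | .u, .phi => -mulOp (totalD wphi * varInv)
  | .phi, .u => mulOp (totalD wphi * varInv)
  | _, _ => 0

/-- Values on the variables of `A_n ↦ ∑_k C(n,k) A_k Q_{n-k}(λφ)`, `φ ↦ φ`. -/
def kpShiftVal (c : K) : MomentIdx → MomentRing K
  | .A n => ∑ k ∈ range (n + 1), n.choose k • (A k * Q (n - k) (c • phi))
  | .phi => phi

/-- Values on the variables of `A_n ↦ ∑_k C(n,k) A_k (λφ)^{n-k}`, `φ ↦ φ`. -/
def benneyShiftVal (c : K) : MomentIdx → MomentRing K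
  | .A n => ∑ k ∈ range (n + 1), n.choose k • (A k * (c • phi) ^ (n - k))
  | .phi => phi

/-- Values on the variables of `u ↦ u + λφ`, `h ↦ h`, `φ ↦ φ`. -/
def waveShiftVal (c : K) : WaveIdx → WaveRing K
  | .u => wu + c • wphi
  | .h => wh
  | .phi => wphi

/-- Values on the variables of `A_n ↦ h Q_n(u)`, `φ ↦ φ`. -/
def kpReductionVal : MomentIdx → WaveRing K
  | .A n => wh * Q n wu
  | .phi => wphi

/-- Values on the variables of `A_n ↦ h u^n`, `φ ↦ φ`. -/
def benneyReductionVal : MomentIdx → WaveRing K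
  | .A n => wh * wu ^ n
  | .phi => wphi

/-- The map `A_n ↦ ∑_k C(n,k) A_k Q_{n-k}(λφ)`, `φ ↦ φ`. -/
def kpShift (c : K) : MomentRing K →ₐ[K] MomentRing K :=
  diffHom (kpShiftVal c) (by simpa [kpShiftVal, Q, A] using isUnit_var (K := K))

/-- The map `A_n ↦ ∑_k C(n,k) A_k (λφ)^{n-k}`, `φ ↦ φ`. -/
def benneyShift (c : K) : MomentRing K →ₐ[K] MomentRing K :=
  diffHom (benneyShiftVal c) (by simpa [benneyShiftVal, A] using isUnit_var (K := K))

/-- The map `u ↦ u + λφ`, `h ↦ h`, `φ ↦ φ`. -/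
def waveShift (c : K) : WaveRing K →ₐ[K] WaveRing K :=
  diffHom (waveShiftVal c) isUnit_var

/-- The map `A_n ↦ h Q_n(u)`, `φ ↦ φ`. -/
def kpReduction : MomentRing K →ₐ[K] WaveRing K :=
  diffHom kpReductionVal (by simpa [kpReductionVal, Q, wh] using isUnit_var (K := K))

/-- The map `A_n ↦ h u^n`, `φ ↦ φ`. -/
def benneyReduction : MomentRing K →ₐ[K] WaveRing K :=
  diffHom benneyReductionVal (by simpa [benneyReductionVal, wh] using isUnit_var (K := K))

end Matrices

end

end KPExt

/-! A differential homomorphism Φ with q_m ↦ g_m transforms variational derivatives by adjoint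
Fréchet derivatives: δΦ(H)/δp_l = ∑_m D_l(g_m)† Φ(δH/δq_m) (`varDeriv_diffHom`). This follows from
the chain rule together with D(∂G)† = D(G)† ∘ (-∂). Hence Φ is Hamiltonian as soon as D(g) B₂ D(g)†
is the image of B₁, entry by entry on the image of Φ (`isHamiltonianMap_diffHom`), and every
Hamiltonian claim becomes an identity between matrix entries.

For KP these identities rest on the calculus of Q_n(w) = (∂ + w)^n(1). The Q_n are of binomial type
(`Q_add`), and the Fréchet derivative of Q_n is ∑_s C(n,s+1) Q_{n-1-s} ∂^s (`partialD_Q`,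
`derivation_Q`), that is, (∂ + w)^n - Q_n divided by ∂ on the right. The φ-row and φ-column of the
matrix contain the same operators with A in place of Q. For the reduction A_n = h Q_n(u), the two
halves of D B D† are h((∂+u)^n - Q_n)Q_m and Q_n(Q_m - (-∂+u)^m)h. The middle terms cancel, and what
is left expands to the KP matrix.

For the shift, the new A_n is the binomial convolution of A with Q(λφ). The A-block transforms into
itself (`sum_kpMatrix_A_A`): on sequences of operators, ∑_μ C(m,μ) T^μ a_{n+m-μ} is the n-th term of
(T + S)^m a, S being the index shift, and convolution with Q intertwines T + S with T + S + w
(`sum_binomTransform`). The contributions through φ cancel, because the φ-column is minus the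
adjoint of the φ-row, convolution passes inside both, and the φφ-entry is zero. In this cancellation
λ is moved across ∂, which is where its constancy enters. The shifts form a one-parameter group
(`kpShift_comp`), so each one is bijective.

The Benney case has the same structure with powers in place of Q_n. Umbrally a_n stands for x^n, and
convolution with w^n replaces x by x + w.

Casimirs: the only nonzero variational derivatives of A_0 φ² are φ² and 2A_0φ, and the A_0-column on
φ² cancels the φ-column on 2A_0φ because (φ_x/A_0)·2A_0φ = ∂(φ²). It is new because δ/δφ kills both
aA_0 and total derivatives, whereas 2A_0φ ≠ 0. -/

namespace KPExt

noncomputable section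

/-! ### Derivations of the jet ring, the chain rule and the criterion for Hamiltonian maps -/

section General

variable {K : Type*} [CommRing K] {ι : Type} {i₀ : ι}

/-- Two derivations along a ring homomorphism out of the jet ring agree if they agree on `K` and
on all variables. -/
theorem derivAlong_ext {S : Type*} [CommRing S] (Φ : JetRing K i₀ →+* S)
    {D₁ D₂ : JetRing K i₀ →+ S}
    (h₁ : ∀ a b, D₁ (a * b) = Φ a * D₁ b + Φ b * D₁ a)
    (h₂ : ∀ a b, D₂ (a * b) = Φ a * D₂ b + Φ b * D₂ a)
    (hK : ∀ c : K, D₁ (algebraMap K _ c) = D₂ (algebraMap K _ c))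
    (hjet : ∀ i j, D₁ (jet i j) = D₂ (jet i j)) : D₁ = D₂ := by
  -- A derivation along Φ is the same as a ring homomorphism Φ + εD into the dual numbers.
  -- Uniqueness for ring homomorphisms then also takes care of the inverted variable.
  have key : ∀ D : JetRing K i₀ →+ S, (∀ a b, D (a * b) = Φ a * D b + Φ b * D a) →
      ∃ F : JetRing K i₀ →+* DualNumber S,
        ∀ a, F a = TrivSqZeroExt.inl (Φ a) + TrivSqZeroExt.inr (D a) := by
    intro D h
    have h1 : D 1 = 0 := by simpa using h 1 1
    refine ⟨{ toFun := fun a => TrivSqZeroExt.inl (Φ a) + TrivSqZeroExt.inr (D a)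
              map_one' := by ext <;> simp [h1]
              map_zero' := by ext <;> simp
              map_add' := fun a b => by
                ext <;> simp
              map_mul' := fun a b => by
                ext <;> simp [h, mul_comm] }, fun a => rfl⟩
  obtain ⟨F₁, hF₁⟩ := key D₁ h₁
  obtain ⟨F₂, hF₂⟩ := key D₂ h₂
  have hF : F₁ = F₂ := jetRing_hom_ext (fun c => by rw [hF₁, hF₂, hK])
    (fun i j => by rw [hF₁, hF₂, hjet])
  ext a
  have := congrArg TrivSqZeroExt.snd (DFunLike.congr_fun hF a)
  simpa [hF₁, hF₂] using this

theorem derivation_ext {D₁ D₂ : Derivation ℤ (JetRing K i₀) (JetRing K i₀)}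
    (hK : ∀ c : K, D₁ (algebraMap K _ c) = D₂ (algebraMap K _ c))
    (hjet : ∀ i j, D₁ (jet i j) = D₂ (jet i j)) : D₁ = D₂ := by
  have := derivAlong_ext (RingHom.id (JetRing K i₀))
    (D₁ := (D₁ : JetRing K i₀ →ₗ[ℤ] JetRing K i₀).toAddMonoidHom)
    (D₂ := (D₂ : JetRing K i₀ →ₗ[ℤ] JetRing K i₀).toAddMonoidHom)
    (fun a b => D₁.leibniz a b) (fun a b => D₂.leibniz a b) hK hjet
  ext a
  exact DFunLike.congr_fun this a

theorem map_smul_of_map_algebraMap {D : Derivation ℤ (JetRing K i₀) (JetRing K i₀)} {c : K}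
    (hD : D (algebraMap K _ c) = 0) (f : JetRing K i₀) : D (c • f) = c • D f := by
  rw [Algebra.smul_def, D.leibniz, hD, smul_zero, add_zero, smul_eq_mul, Algebra.smul_def]

/-- Sending every jet to 1 is allowed, since 1 is a unit, and maps the ring to the nontrivial ring
`K`. -/
theorem nontrivial_jetRing [Nontrivial K] : Nontrivial (JetRing K i₀) :=
  RingHom.domain_nontrivial
    (algHomExt (i₀ := i₀) (fun _ : ι × ℕ => (1 : K)) isUnit_one : JetRing K i₀ →ₐ[K] K).toRingHom

theorem mulOp_apply (a f : JetRing K i₀) : mulOp a f = a * f := rfl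

theorem partialD_smul (w : ι × ℕ) (c : K) (f : JetRing K i₀) :
    partialD w (c • f) = c • partialD w f :=
  map_smul_of_map_algebraMap (partialD_algebraMap w c) f

theorem exists_partialD_eq_zero (i : ι) (G : JetRing K i₀) :
    ∃ N, ∀ j, N ≤ j → partialD (i, j) G = 0 := by
  have h := (partialD_support_finite G).preimage (f := fun j : ℕ => (i, j))
    (fun a _ b _ h => (Prod.mk.inj h).2)
  obtain ⟨N, hN⟩ := h.bddAbove
  refine ⟨N + 1, fun j hj => ?_⟩
  by_contra hne
  have : j ≤ N := hN hne
  omega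

/-- Both sides are derivations along Φ in `H`, vanish on `K` and agree on the jets. Finiteness of
the set of jets on which `H` depends makes the right side additive. -/
theorem chain_rule {κ : Type} {k₀ : κ} (Φ : JetRing K i₀ →ₐ[K] JetRing K k₀)
    (D : Derivation ℤ (JetRing K k₀) (JetRing K k₀)) (hD : ∀ c : K, D (algebraMap K _ c) = 0)
    (H : JetRing K i₀) :
    D (Φ H) = ∑ᶠ w : ι × ℕ, Φ (partialD w H) * D (Φ (jet w.1 w.2)) := by
  have fin : ∀ H : JetRing K i₀, (Function.support fun w : ι × ℕ =>
      Φ (partialD w H) * D (Φ (jet w.1 w.2))).Finite := fun H =>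
    (partialD_support_finite H).subset fun w hw h => hw (by simp [h])
  have := derivAlong_ext (K := K) (i₀ := i₀) Φ.toRingHom
    (D₁ := (D : JetRing K k₀ →ₗ[ℤ] JetRing K k₀).toAddMonoidHom.comp
      (Φ : JetRing K i₀ →+ JetRing K k₀))
    (D₂ := { toFun := fun H => ∑ᶠ w : ι × ℕ, Φ (partialD w H) * D (Φ (jet w.1 w.2))
             map_zero' := by simp
             map_add' := fun a b => by
              rw [← finsum_add_distrib (fin a) (fin b)]
              simp only [map_add, add_mul] })
    (fun a b => by simp)
    (fun a b => by
      change (∑ᶠ w : ι × ℕ, Φ (partialD w (a * b)) * D (Φ (jet w.1 w.2))) =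
        Φ a * (∑ᶠ w : ι × ℕ, Φ (partialD w b) * D (Φ (jet w.1 w.2))) +
        Φ b * (∑ᶠ w : ι × ℕ, Φ (partialD w a) * D (Φ (jet w.1 w.2)))
      rw [mul_finsum' _ _ (fin b), mul_finsum' _ _ (fin a), ← finsum_add_distrib
        ((fin b).subset fun w hw h => hw (by simp only [h, mul_zero]))
        ((fin a).subset fun w hw h => hw (by simp only [h, mul_zero]))]
      refine finsum_congr fun w => ?_
      rw [Derivation.leibniz, smul_eq_mul, smul_eq_mul, map_add, map_mul, map_mul]
      ring)
    (fun c => by simp [hD, partialD_algebraMap])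
    (fun i j => by
      change D (Φ (jet i j)) = ∑ᶠ w : ι × ℕ, Φ (partialD w (jet i j)) * D (Φ (jet w.1 w.2))
      rw [finsum_eq_single _ (i, j)]
      · rw [partialD_jet, if_pos rfl, map_one, one_mul]
      · intro w hw
        rw [partialD_jet, if_neg (Ne.symm hw), map_zero, zero_mul])
  exact DFunLike.congr_fun this H

variable [Differential K]

theorem del_apply (f : JetRing K i₀) : del f = totalD f := rfl

theorem del_pow_zero_apply (f : JetRing K i₀) :
    (del ^ 0 : Module.End ℤ (JetRing K i₀)) f = f := rfl

theorem del_pow_succ_apply (j : ℕ) (f : JetRing K i₀) :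
    (del ^ (j + 1) : Module.End ℤ (JetRing K i₀)) f = totalD ((del ^ j) f) := by
  rw [pow_succ']; rfl

theorem neg_del_pow_succ_apply (j : ℕ) (f : JetRing K i₀) :
    ((-del) ^ (j + 1) : Module.End ℤ (JetRing K i₀)) f = ((-del) ^ j) (-totalD f) := by
  rw [pow_succ]; rfl

theorem totalD_jet (i : ι) (j : ℕ) : totalD (jet i j : JetRing K i₀) = jet i (j + 1) :=
  derivExt_jet _ _ i j

theorem totalD_algebraMap (c : K) :
    totalD (algebraMap K (JetRing K i₀) c) = algebraMap K _ (Differential.deriv c) :=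
  derivExt_algebraMap _ _ c

theorem totalD_smul {c : K} (hc : Differential.deriv c = 0) (f : JetRing K i₀) :
    totalD (c • f) = c • totalD f :=
  map_smul_of_map_algebraMap (by rw [totalD_algebraMap, hc, map_zero]) f

theorem del_pow_smul {c : K} (hc : Differential.deriv c = 0) (j : ℕ) (f : JetRing K i₀) :
    (del ^ j) (c • f) = c • (del ^ j) f := by
  induction j with
  | zero => rfl
  | succ j ih => rw [del_pow_succ_apply, ih, totalD_smul hc, del_pow_succ_apply]

theorem neg_del_pow_smul {c : K} (hc : Differential.deriv c = 0) (j : ℕ) (f : JetRing K i₀) :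
    ((-del) ^ j : Module.End ℤ (JetRing K i₀)) (c • f) = c • ((-del) ^ j) f := by
  rcases Nat.even_or_odd j with h | h
  · rw [h.neg_pow, del_pow_smul hc]
  · rw [h.neg_pow, LinearMap.neg_apply, LinearMap.neg_apply, del_pow_smul hc, smul_neg]

theorem evolution_jet (Z : ι → JetRing K i₀) (i : ι) (j : ℕ) :
    evolution Z (jet i j) = (del ^ j) (Z i) :=
  derivExt_jet _ _ i j

theorem evolution_var (Z : ι → JetRing K i₀) (i : ι) : evolution Z (var i) = Z i :=
  derivExt_jet _ _ i 0

theorem evolution_algebraMap (Z : ι → JetRing K i₀) (c : K) :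
    evolution Z (algebraMap K _ c) = 0 :=
  (derivExt_algebraMap _ _ c).trans (map_zero _)

theorem evolution_smul (Z : ι → JetRing K i₀) (c : K) (f : JetRing K i₀) :
    evolution Z (c • f) = c • evolution Z f :=
  map_smul_of_map_algebraMap (evolution_algebraMap Z c) f

theorem evolution_add (Z₁ Z₂ : ι → JetRing K i₀) :
    evolution (Z₁ + Z₂) = evolution Z₁ + evolution Z₂ := by
  apply derivation_ext
  · intro c
    simp [evolution_algebraMap]
  · intro i j
    simp [evolution_jet]

theorem evolution_zero : evolution (0 : ι → JetRing K i₀) = 0 := by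
  apply derivation_ext
  · intro c
    simp [evolution_algebraMap]
  · intro i j
    simp [evolution_jet]

/-- The evolution field as an additive function of the right hand sides. -/
def evolutionHom (f : JetRing K i₀) : (ι → JetRing K i₀) →+ JetRing K i₀ where
  toFun Z := evolution Z f
  map_zero' := by rw [evolution_zero]; rfl
  map_add' Z₁ Z₂ := by rw [evolution_add]; rfl

/-- The commutator of two derivations is a derivation, so it suffices that it vanishes on
coefficients and jets. -/
theorem evolution_totalD (Z : ι → JetRing K i₀) (f : JetRing K i₀) :
    evolution Z (totalD f) = totalD (evolution Z f) := by
  have h : ⁅evolution Z, (totalD : Derivation ℤ (JetRing K i₀) (JetRing K i₀))⁆ = 0 := by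
    apply derivation_ext
    · intro c
      simp [Derivation.commutator_apply, totalD_algebraMap, evolution_algebraMap]
    · intro i j
      simp [Derivation.commutator_apply, totalD_jet, evolution_jet, del_pow_succ_apply]
  have := DFunLike.congr_fun h f
  rwa [Derivation.commutator_apply, Derivation.zero_apply, sub_eq_zero] at this

theorem partialD_zero_totalD (i : ι) (f : JetRing K i₀) :
    partialD (i, 0) (totalD f) = totalD (partialD (i, 0) f) := by
  have h : ⁅(partialD (i, 0) : Derivation ℤ (JetRing K i₀) (JetRing K i₀)), (totalD : Derivation ℤ (JetRing K i₀) (JetRing K i₀))⁆ = 0 := by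
    apply derivation_ext
    · intro c
      simp [Derivation.commutator_apply, totalD_algebraMap, partialD_algebraMap]
    · intro i' j'
      rw [Derivation.commutator_apply, totalD_jet, partialD_jet, partialD_jet]
      split_ifs <;> simp_all
  have := DFunLike.congr_fun h f
  rwa [Derivation.commutator_apply, Derivation.zero_apply, sub_eq_zero] at this

/-- The commutator of ∂/∂q_i^{(j+1)} with ∂ is ∂/∂q_i^{(j)}, as is checked on jets. This term
produces both the integration by parts below and the Pascal recursion for the partial derivatives of
Q_n. -/
theorem partialD_succ_totalD (i : ι) (j : ℕ) (f : JetRing K i₀) :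
    partialD (i, j + 1) (totalD f) = totalD (partialD (i, j + 1) f) + partialD (i, j) f := by
  have h : ⁅(partialD (i, j + 1) : Derivation ℤ (JetRing K i₀) (JetRing K i₀)),
      (totalD : Derivation ℤ (JetRing K i₀) (JetRing K i₀))⁆ =
      partialD (i, j) := by
    apply derivation_ext
    · intro c
      simp [Derivation.commutator_apply, totalD_algebraMap, partialD_algebraMap]
    · intro i' j'
      rw [Derivation.commutator_apply, totalD_jet, partialD_jet, partialD_jet, partialD_jet]
      split_ifs <;> simp_all
  have := DFunLike.congr_fun h f
  rw [Derivation.commutator_apply] at this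
  rw [← this]
  ring

/-! ### The adjoint of the Fréchet derivative -/

theorem adjFrechet_support_finite (i : ι) (G F : JetRing K i₀) :
    {j | ((-del) ^ j : Module.End ℤ (JetRing K i₀)) (F * partialD (i, j) G) ≠ 0}.Finite := by
  refine ((partialD_support_finite G).preimage (f := fun j : ℕ => (i, j))
    (fun a _ b _ h => (Prod.mk.inj h).2)).subset fun j hj h => hj ?_
  rw [h, mul_zero, map_zero]

/-- The adjoint of the Fréchet derivative of `G` with respect to the variable `q_i`:
`F ↦ ∑_j (-∂)^j (F ∂G/∂q_i^{(j)})`. -/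
def adjFrechet (i : ι) (G : JetRing K i₀) : JetRing K i₀ →+ JetRing K i₀ where
  toFun F := ∑ᶠ j : ℕ, ((-del) ^ j : Module.End ℤ (JetRing K i₀)) (F * partialD (i, j) G)
  map_zero' := by simp
  map_add' F₁ F₂ := by
    rw [← finsum_add_distrib (adjFrechet_support_finite i G F₁)
      (adjFrechet_support_finite i G F₂)]
    simp only [add_mul, map_add]

theorem adjFrechet_apply (i : ι) (G F : JetRing K i₀) : adjFrechet i G F =
    ∑ᶠ j : ℕ, ((-del) ^ j : Module.End ℤ (JetRing K i₀)) (F * partialD (i, j) G) := rfl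

theorem adjFrechet_one (i : ι) (G : JetRing K i₀) : adjFrechet i G 1 = varDeriv i G := by
  simp [adjFrechet_apply, varDeriv]

theorem adjFrechet_eq_sum (i : ι) (G F : JetRing K i₀) (N : ℕ)
    (hN : ∀ j, N ≤ j → partialD (i, j) G = 0) : adjFrechet i G F =
    ∑ j ∈ range N, ((-del) ^ j : Module.End ℤ (JetRing K i₀)) (F * partialD (i, j) G) := by
  rw [adjFrechet_apply]
  apply finsum_eq_sum_of_support_subset
  intro j hj
  rw [coe_range, Set.mem_Iio]
  by_contra h
  exact hj (by simp only [hN j (not_lt.mp h), mul_zero, map_zero])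

theorem adjFrechet_eq_zero (i : ι) (G F : JetRing K i₀)
    (h : ∀ j, partialD (i, j) G = 0) : adjFrechet i G F = 0 := by
  rw [adjFrechet_eq_sum i G F 0 (fun j _ => h j), sum_range_zero]

/-- The Fréchet derivative of ∂G is ∂ composed with that of G; this is the adjoint form of that
fact. -/
theorem adjFrechet_totalD (i : ι) (G F : JetRing K i₀) :
    adjFrechet i (totalD G) F = adjFrechet i G (-totalD F) := by
  obtain ⟨N, hN⟩ := exists_partialD_eq_zero i G
  rw [adjFrechet_eq_sum i (totalD G) F (N + 1), adjFrechet_eq_sum i G _ N hN, sum_range_succ']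
  · have h1 : ∀ j, ((-del) ^ (j + 1) : Module.End ℤ (JetRing K i₀))
        (F * partialD (i, j + 1) (totalD G)) =
        ((-del) ^ (j + 1)) (F * totalD (partialD (i, j + 1) G)) +
          ((-del) ^ j) (-totalD (F * partialD (i, j) G)) := by
      intro j
      rw [partialD_succ_totalD, mul_add, map_add, ← neg_del_pow_succ_apply]
    simp only [h1, sum_add_distrib, partialD_zero_totalD]
    -- The isolated term j = 0 completes the first sum to j ≤ N, whose last term vanishes by the
    -- choice of `N`. The two sums then combine termwise by F ∂G_j - ∂(F G_j) = -(∂F) G_j, where G_j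
    -- is the j-th partial derivative.
    rw [add_right_comm,
      ← sum_range_succ' (fun j => ((-del) ^ j : Module.End ℤ (JetRing K i₀))
        (F * totalD (partialD (i, j) G))), sum_range_succ, hN N le_rfl, map_zero, mul_zero,
      map_zero, add_zero, ← sum_add_distrib]
    refine sum_congr rfl fun j _ => ?_
    rw [← map_add]
    congr 1
    rw [Derivation.leibniz, smul_eq_mul, smul_eq_mul]
    ring
  · intro j hj
    obtain ⟨j, rfl⟩ : ∃ k, j = k + 1 := ⟨j - 1, by omega⟩
    rw [partialD_succ_totalD, hN _ (by omega), hN _ (by omega), map_zero, add_zero]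

/-- Integration by parts with the test function 1, whose derivative is zero. -/
theorem varDeriv_totalD (i : ι) (G : JetRing K i₀) : varDeriv i (totalD G) = 0 := by
  rw [← adjFrechet_one, adjFrechet_totalD, Derivation.map_one_eq_zero, neg_zero, map_zero]

theorem adjFrechet_del_pow (i : ι) (G F : JetRing K i₀) (n : ℕ) :
    adjFrechet i ((del ^ n) G) F = adjFrechet i G (((-del) ^ n) F) := by
  induction n generalizing F with
  | zero => rfl
  | succ n ih => rw [del_pow_succ_apply, adjFrechet_totalD, ih, neg_del_pow_succ_apply]

/-! ### Differential homomorphisms -/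

variable {κ : Type} {k₀ : κ}

theorem diffHom_jet (g : ι → JetRing K k₀) (hg : IsUnit (g i₀)) (i : ι) (j : ℕ) :
    (diffHom g hg : JetRing K i₀ →ₐ[K] JetRing K k₀) (jet i j) = (del ^ j) (g i) :=
  algHomExt_jet _ _ i j

theorem diffHom_totalD (g : ι → JetRing K k₀) (hg : IsUnit (g i₀)) (f : JetRing K i₀) :
    (diffHom g hg : JetRing K i₀ →ₐ[K] JetRing K k₀) (totalD f) = totalD (diffHom g hg f) := by
  set Φ : JetRing K i₀ →ₐ[K] JetRing K k₀ := diffHom g hg with hΦ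
  have := derivAlong_ext (K := K) (i₀ := i₀) Φ.toRingHom
    (D₁ := (Φ : JetRing K i₀ →+ JetRing K k₀).comp
      (totalD (K := K) (i₀ := i₀)).toLinearMap.toAddMonoidHom)
    (D₂ := (totalD (K := K) (i₀ := k₀)).toLinearMap.toAddMonoidHom.comp
      (Φ : JetRing K i₀ →+ JetRing K k₀))
    (fun a b => by simp) (fun a b => by simp)
    (fun c => by simp [totalD_algebraMap])
    (fun i j => by simp [totalD_jet, hΦ, diffHom_jet, del_pow_succ_apply])
  exact DFunLike.congr_fun this f

theorem diffHom_del_pow (g : ι → JetRing K k₀) (hg : IsUnit (g i₀)) (n : ℕ) (f : JetRing K i₀) :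
    (diffHom g hg : JetRing K i₀ →ₐ[K] JetRing K k₀) ((del ^ n) f) =
      (del ^ n) (diffHom g hg f) := by
  induction n with
  | zero => rfl
  | succ n ih => rw [del_pow_succ_apply, diffHom_totalD, ih, del_pow_succ_apply]

theorem diffHom_neg_del_pow (g : ι → JetRing K k₀) (hg : IsUnit (g i₀)) (n : ℕ)
    (f : JetRing K i₀) :
    (diffHom g hg : JetRing K i₀ →ₐ[K] JetRing K k₀) (((-del) ^ n) f) =
      ((-del) ^ n) (diffHom g hg f) := by
  induction n generalizing f with
  | zero => rfl
  | succ n ih =>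
    rw [neg_del_pow_succ_apply, ih, map_neg, diffHom_totalD, ← neg_del_pow_succ_apply]

/-- Compatibility with ∂ propagates agreement from q_i to all its jets. -/
theorem diffHom_ext {Φ Ψ : JetRing K i₀ →ₐ[K] JetRing K k₀}
    (hΦ : ∀ f, Φ (totalD f) = totalD (Φ f)) (hΨ : ∀ f, Ψ (totalD f) = totalD (Ψ f))
    (h : ∀ i, Φ (var i) = Ψ (var i)) : Φ = Ψ := by
  have : (Φ : JetRing K i₀ →+* JetRing K k₀) = Ψ := by
    apply jetRing_hom_ext
    · intro c
      simp
    · intro i j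
      change Φ (jet i j) = Ψ (jet i j)
      induction j with
      | zero => exact h i
      | succ j ih => rw [← totalD_jet, hΦ, hΨ, ih]
  ext f
  exact DFunLike.congr_fun this f

theorem adjFrechet_support_finite' (F : ι → JetRing K i₀) (g : JetRing K i₀) :
    (Function.support fun l => adjFrechet l g (F l)).Finite := by
  refine ((partialD_support_finite g).image Prod.fst).subset fun l hl => ?_
  by_contra h
  refine hl (adjFrechet_eq_zero l g _ fun j => ?_)
  by_contra h'
  exact h ⟨(l, j), h', rfl⟩

/-- The chain rule writes ∂Φ(H)/∂p_l^{(j)} as a sum over jets q_m^{(r)}, with image ∂^r(g_m). Moving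
∂^r to the other side of the adjoint gives (-∂)^r, and these powers assemble Φ(δH/δq_m). -/
theorem varDeriv_diffHom (g : ι → JetRing K k₀) (hg : IsUnit (g i₀)) (l : κ) (H : JetRing K i₀) :
    varDeriv l (diffHom g hg H : JetRing K k₀) =
      ∑ᶠ m : ι, adjFrechet l (g m) (diffHom g hg (varDeriv m H)) := by
  classical
  set Φ : JetRing K i₀ →ₐ[K] JetRing K k₀ := diffHom g hg with hΦ
  have hfin := partialD_support_finite H
  set T : Finset ι := hfin.toFinset.image Prod.fst with hT
  obtain ⟨N, hN⟩ : ∃ N, ∀ w, partialD w H ≠ 0 → w.2 < N := by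
    obtain ⟨N, hN⟩ := (hfin.image Prod.snd).bddAbove
    exact ⟨N + 1, fun w hw => Nat.lt_succ_of_le (hN ⟨w, hw, rfl⟩)⟩
  -- One finite box containing all jets of `H` turns every `finsum` into a finite sum, so that the
  -- sums may be interchanged.
  have hS : ∀ w, partialD w H ≠ 0 → w ∈ T ×ˢ range N := by
    intro w hw
    rw [mem_product, mem_range]
    exact ⟨mem_image.mpr ⟨w, hfin.mem_toFinset.mpr hw, rfl⟩, hN w hw⟩
  have h1 : ∀ j, partialD (l, j) (Φ H) =
      ∑ w ∈ T ×ˢ range N, Φ (partialD w H) * partialD (l, j) ((del ^ w.2) (g w.1)) := by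
    intro j
    rw [chain_rule Φ _ (partialD_algebraMap _)]
    simp only [hΦ, diffHom_jet]
    apply finsum_eq_sum_of_support_subset
    intro w hw
    rw [Finset.mem_coe]
    exact hS w fun h => hw (by simp [h])
  have h2 : ∀ m, varDeriv m H =
      ∑ j ∈ range N, ((-del) ^ j : Module.End ℤ (JetRing K i₀)) (partialD (m, j) H) := by
    intro m
    apply finsum_eq_sum_of_support_subset
    intro j hj
    rw [coe_range, Set.mem_Iio]
    exact hN (m, j) fun h => hj (by simp [h])
  rw [varDeriv]
  simp only [h1, map_sum]
  rw [finsum_sum_comm _ _ fun w _ => adjFrechet_support_finite _ _ _]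
  rw [finsum_eq_sum_of_support_subset (s := T), sum_product]
  · refine sum_congr rfl fun m _ => ?_
    rw [h2, map_sum, map_sum]
    refine sum_congr rfl fun j _ => ?_
    rw [← adjFrechet_apply, adjFrechet_del_pow, hΦ, diffHom_neg_del_pow]
  · intro m hm
    by_contra hmT
    refine hm ?_
    have : varDeriv m H = 0 := by
      rw [h2]
      refine sum_eq_zero fun j _ => ?_
      by_contra h
      exact hmT (mem_product.mp (hS (m, j) fun h' => h (by rw [h', map_zero]))).1
    change adjFrechet l (g m) (Φ (varDeriv m H)) = 0
    rw [this, map_zero, map_zero]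

/-- A differential homomorphism is Hamiltonian if the matrix of the source goes to the matrix of
the target, transformed by the Fréchet derivative and its adjoint. -/
theorem isHamiltonianMap_diffHom (B₁ : ι → ι → Module.End ℤ (JetRing K i₀))
    (B₂ : κ → κ → Module.End ℤ (JetRing K k₀)) (g : ι → JetRing K k₀) (hg : IsUnit (g i₀))
    (h : ∀ i m v, evolution (fun k => ∑ᶠ l, B₂ k l (adjFrechet l (g m) (diffHom g hg v))) (g i) =
      diffHom g hg (B₁ i m v)) :
    IsHamiltonianMap B₁ B₂ (diffHom g hg) := by
  classical
  refine ⟨diffHom_totalD g hg, fun H f => ?_⟩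
  set Φ : JetRing K i₀ →ₐ[K] JetRing K k₀ := diffHom g hg with hΦ
  have hv := (varDeriv_support_finite H).2
  have hR₁ : ∀ i, hamRHS B₁ H i = ∑ m ∈ hv.toFinset, B₁ i m (varDeriv m H) := by
    intro i
    apply finsum_eq_sum_of_support_subset
    intro m hm
    rw [Finset.mem_coe, Set.Finite.mem_toFinset]
    exact fun h => hm (by simp [h])
  -- The target motion equations split into one family for each variable q_m of the source, so the
  -- evolution field splits as well and the hypothesis applies to each m separately.
  have hR₂ : hamRHS B₂ (Φ H) = ∑ m ∈ hv.toFinset,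
      fun k => ∑ᶠ l, B₂ k l (adjFrechet l (g m) (Φ (varDeriv m H))) := by
    ext k
    rw [Finset.sum_apply, hamRHS, ← finsum_sum_comm]
    · refine finsum_congr fun l => ?_
      rw [← map_sum, hΦ, varDeriv_diffHom]
      congr 1
      apply finsum_eq_sum_of_support_subset
      intro m hm
      rw [Finset.mem_coe, Set.Finite.mem_toFinset]
      exact fun h => hm (by simp [h])
    · intro m _
      exact (adjFrechet_support_finite' (fun _ => Φ (varDeriv m H)) (g m)).subset
        fun l hl h => hl (by simp only [h, map_zero])
  have hvar : ∀ i, Φ (hamField B₁ H (var i)) = hamField B₂ (Φ H) (g i) := by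
    intro i
    rw [hamField, evolution_var, hR₁, map_sum, hamField, hR₂]
    change _ = evolutionHom (g i) _
    rw [map_sum]
    exact sum_congr rfl fun m _ => (h i m _).symm
  -- Both composites are derivations along Φ, and both fields commute with ∂, so agreement on the
  -- q_i is enough.
  have := derivAlong_ext (K := K) (i₀ := i₀) Φ.toRingHom
    (D₁ := (Φ : JetRing K i₀ →+ JetRing K k₀).comp
      (hamField B₁ H : JetRing K i₀ →ₗ[ℤ] JetRing K i₀).toAddMonoidHom)
    (D₂ := (hamField B₂ (Φ H) : JetRing K k₀ →ₗ[ℤ] JetRing K k₀).toAddMonoidHom.comp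
      (Φ : JetRing K i₀ →+ JetRing K k₀))
    (fun a b => by simp) (fun a b => by simp)
    (fun c => by simp [hamField, evolution_algebraMap])
    (fun i j => by
      change Φ (hamField B₁ H (jet i j)) = hamField B₂ (Φ H) (Φ (jet i j))
      induction j with
      | zero => rw [show (jet i 0 : JetRing K i₀) = var i from rfl, hvar, hΦ, diffHom_var]
      | succ j ih =>
        rw [hamField, hamField] at ih ⊢
        rw [← totalD_jet, evolution_totalD, hΦ, diffHom_totalD, diffHom_totalD, evolution_totalD,
          ← hΦ, ih])
  exact DFunLike.congr_fun this f

/-- A Hamiltonian differential homomorphism with a two-sided inverse is an automorphism. -/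
theorem isHamiltonianAut_of_inverse {B : ι → ι → Module.End ℤ (JetRing K i₀)}
    {Φ Ψ : JetRing K i₀ →ₐ[K] JetRing K i₀} (hΦ : IsHamiltonianMap B B Φ)
    (h₁ : Φ.comp Ψ = AlgHom.id K _) (h₂ : Ψ.comp Φ = AlgHom.id K _) : IsHamiltonianAut B Φ :=
  ⟨Function.bijective_iff_has_inverse.mpr ⟨Ψ, DFunLike.congr_fun h₂, DFunLike.congr_fun h₁⟩, hΦ⟩

end General

section Binomial

/-! ### Binomial expansions -/

/-- The binomial expansion of `(T + w)^m` for noncommuting `T` and `w`, when the `q_j` satisfy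
`q_j (T + w) = T q_j + q_{j+1}`. -/
theorem mul_add_pow_eq_sum {E : Type*} [Ring E] (T w : E) (q : ℕ → E)
    (hq : ∀ j, q j * (T + w) = T * q j + q (j + 1)) (n m : ℕ) :
    q n * (T + w) ^ m = ∑ l ∈ range (m + 1), m.choose l • (T ^ l * q (n + (m - l))) := by
  induction m generalizing n with
  | zero => simp
  | succ m ih =>
    -- Carrying one factor T + w across q_n yields T q_n and q_{n+1}; these are the two halves of
    -- Pascal's rule.
    rw [sum_choose_succ_nsmul (fun i j => T ^ i * q (n + j)), pow_succ', ← mul_assoc, hq, add_mul,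
      mul_assoc, ih n, ih (n + 1), add_comm, mul_sum]
    congr 1
    · refine sum_congr rfl fun l hl => ?_
      rw [mem_range] at hl
      rw [show n + 1 + (m - l) = n + (m + 1 - l) by omega]
    · refine sum_congr rfl fun l _ => ?_
      rw [mul_smul_comm, ← mul_assoc, ← pow_succ']

/-- The mirror image of `mul_add_pow_eq_sum`. -/
theorem add_pow_mul_eq_sum {E : Type*} [Ring E] (D w : E) (q : ℕ → E)
    (hq : ∀ j, (D + w) * q j = q j * D + q (j + 1)) (n m : ℕ) :
    (D + w) ^ m * q n = ∑ l ∈ range (m + 1), m.choose l • (q (n + (m - l)) * D ^ l) := by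
  induction m generalizing n with
  | zero => simp
  | succ m ih =>
    rw [sum_choose_succ_nsmul (fun i j => q (n + j) * D ^ i), pow_succ, mul_assoc, hq, mul_add,
      ← mul_assoc, ih n, ih (n + 1), add_comm, sum_mul]
    congr 1
    · refine sum_congr rfl fun l hl => ?_
      rw [mem_range] at hl
      rw [show n + 1 + (m - l) = n + (m + 1 - l) by omega]
    · refine sum_congr rfl fun l _ => ?_
      rw [smul_mul_assoc, mul_assoc, ← pow_succ]

/-! ### Binomial transforms as operators on sequences -/

section Shift

variable {M : Type*} [AddCommGroup M]

theorem sum_choose_succ_smul (f : ℕ → ℕ → M) (n : ℕ) :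
    ∑ i ∈ range (n + 2), (n + 1).choose i • f i (n + 1 - i) =
      ∑ i ∈ range (n + 1), n.choose i • f i (n + 1 - i) +
        ∑ i ∈ range (n + 1), n.choose i • f (i + 1) (n - i) := by
  rw [sum_range_succ', sum_range_succ' (fun i => n.choose i • f i (n + 1 - i))]
  have h : ∑ i ∈ range n, n.choose (i + 1) • f (i + 1) (n + 1 - (i + 1)) =
      ∑ i ∈ range (n + 1), n.choose (i + 1) • f (i + 1) (n - i) := by
    rw [sum_range_succ _ n, Nat.choose_succ_self, zero_smul, add_zero]
    exact sum_congr rfl fun i _ => by rw [Nat.add_sub_add_right]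
  rw [h, add_right_comm, ← sum_add_distrib]
  simp only [Nat.choose_succ_succ, add_smul, Nat.add_sub_add_right, Nat.choose_zero_right]
  congr 1
  exact sum_congr rfl fun i _ => add_comm _ _

/-- The shift of sequences. -/
def seqShift : Module.End ℤ (ℕ → M) := LinearMap.funLeft ℤ M (· + 1)

/-- An operator applied to all terms of a sequence. -/
def seqMap (T : Module.End ℤ M) : Module.End ℤ (ℕ → M) := T.compLeft ℕ

theorem seqShift_apply (a : ℕ → M) (n : ℕ) : (seqShift : Module.End ℤ (ℕ → M)) a n = a (n + 1) := rfl

theorem seqMap_apply (T : Module.End ℤ M) (a : ℕ → M) (n : ℕ) : seqMap T a n = T (a n) := rfl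

theorem seqShift_pow_apply (j : ℕ) (a : ℕ → M) (n : ℕ) :
    (seqShift ^ j : Module.End ℤ (ℕ → M)) a n = a (n + j) := by
  induction j generalizing a with
  | zero => rfl
  | succ j ih =>
    rw [pow_succ]
    change (seqShift ^ j : Module.End ℤ (ℕ → M)) ((seqShift : Module.End ℤ (ℕ → M)) a) n = _
    rw [ih, seqShift_apply]
    rfl

theorem seqMap_pow_apply (T : Module.End ℤ M) (j : ℕ) (a : ℕ → M) (n : ℕ) :
    (seqMap T ^ j) a n = (T ^ j) (a n) := by
  induction j generalizing a with
  | zero => rfl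
  | succ j ih =>
    rw [pow_succ, pow_succ]
    change (seqMap T ^ j) (seqMap T a) n = _
    rw [ih]
    rfl

/-- Acting on the terms commutes with shifting the index, so the ordinary binomial theorem applies.
The sums in the KP matrix thereby become powers of one operator. -/
theorem seqShift_add_seqMap_pow_apply (T : Module.End ℤ M) (m : ℕ) (a : ℕ → M) (n : ℕ) :
    ((seqMap T + seqShift) ^ m : Module.End ℤ (ℕ → M)) a n =
      ∑ l ∈ range (m + 1), m.choose l • (T ^ l) (a (n + (m - l))) := by
  have hc : Commute (seqMap T) (seqShift : Module.End ℤ (ℕ → M)) := rfl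
  rw [hc.add_pow]
  simp only [LinearMap.sum_apply, Finset.sum_apply]
  refine sum_congr rfl fun l _ => ?_
  rw [← nsmul_eq_mul', LinearMap.smul_apply, Pi.smul_apply, Module.End.mul_apply,
    seqMap_pow_apply, seqShift_pow_apply]

/-- The binomial transform `b_n = ∑_k C(n,k) q_{n-k} a_k` of a sequence. -/
def binomTransform (q : ℕ → Module.End ℤ M) : Module.End ℤ (ℕ → M) where
  toFun a n := ∑ k ∈ range (n + 1), n.choose k • q (n - k) (a k)
  map_add' a b := by
    ext n
    simp only [Pi.add_apply, map_add, smul_add, sum_add_distrib]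
  map_smul' c a := by
    ext n
    simp only [Pi.smul_apply, map_smul, smul_sum, RingHom.id_apply]
    exact sum_congr rfl fun k _ => smul_comm _ _ _

theorem binomTransform_apply (q : ℕ → Module.End ℤ M) (a : ℕ → M) (n : ℕ) :
    binomTransform q a n = ∑ k ∈ range (n + 1), n.choose k • q (n - k) (a k) := rfl

/-- The binomial transform intertwines `T + shift` and `T + w + shift`. -/
theorem seqShift_mul_binomTransform (T w : Module.End ℤ M) (q : ℕ → Module.End ℤ M)
    (hq : ∀ j, q j * (T + w) = T * q j + q (j + 1)) :
    (seqMap T + seqShift) * binomTransform q =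
      binomTransform q * (seqMap T + seqShift + seqMap w) := by
  ext1 a
  ext n
  have hq' : ∀ j x, q j (T x) + q j (w x) = T (q j x) + q (j + 1) x := fun j x => by
    have := LinearMap.congr_fun (hq j) x
    simpa using this
  simp only [Module.End.mul_apply, LinearMap.add_apply, Pi.add_apply, seqMap_apply, seqShift_apply,
    binomTransform_apply]
  rw [sum_choose_succ_smul (fun i j => q j (a i)), map_sum, ← sum_add_distrib, ← sum_add_distrib]
  refine sum_congr rfl fun k hk => ?_
  rw [mem_range] at hk
  rw [map_nsmul, ← smul_add, ← smul_add]
  congr 1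
  rw [map_add, map_add, show n + 1 - k = n - k + 1 by omega, ← add_assoc, ← hq' (n - k) (a k)]
  abel

/-- The left side is the n-th term of (T + S)^m applied to the transform, with S the shift. The
intertwining relation turns this into the transform of (T + S + w)^m a, and this power expands once
more by moving w into the q_j. -/
theorem sum_binomTransform (T w : Module.End ℤ M) (q : ℕ → Module.End ℤ M) (hq₀ : q 0 = 1)
    (hq : ∀ j, q j * (T + w) = T * q j + q (j + 1)) (a : ℕ → M) (n m : ℕ) :
    ∑ μ ∈ range (m + 1), m.choose μ • (T ^ μ) (binomTransform q a (n + (m - μ))) =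
      ∑ k ∈ range (n + 1), n.choose k • q (n - k) (∑ l ∈ range (m + 1), m.choose l •
        ∑ μ ∈ range (l + 1), l.choose μ • (T ^ μ) (q (m - l) (a (k + (l - μ))))) := by
  have h1 : (seqMap T + seqShift) ^ m * binomTransform q =
      binomTransform q * (seqMap T + seqShift + seqMap w) ^ m :=
    SemiconjBy.pow_right (a := binomTransform q) (x := seqMap T + seqShift + seqMap w)
      (y := seqMap T + seqShift) (seqShift_mul_binomTransform T w q hq).symm m |>.symm
  -- The expansion is applied with T + S in the role of T, which is legitimate because q_j acts
  -- termwise and commutes with S. It starts at q_0 = 1, so the left side is the bare power.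
  have h2 := mul_add_pow_eq_sum (seqMap T + seqShift) (seqMap w) (fun j => seqMap (q j))
    (fun j => by
      ext1 b
      ext i
      have := LinearMap.congr_fun (hq j) (b i)
      simp only [Module.End.mul_apply, LinearMap.add_apply, Pi.add_apply, seqMap_apply,
        seqShift_apply, map_add] at this ⊢
      rw [add_right_comm, this]
      abel) 0 m
  have hq₀' : seqMap (q 0) = 1 := by
    rw [hq₀]
    rfl
  rw [hq₀', one_mul] at h2
  rw [← seqShift_add_seqMap_pow_apply, ← Module.End.mul_apply, h1, h2, Module.End.mul_apply,
    binomTransform_apply]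
  refine sum_congr rfl fun k _ => ?_
  simp only [LinearMap.sum_apply, Finset.sum_apply]
  congr 2
  refine sum_congr rfl fun l _ => ?_
  rw [LinearMap.smul_apply, Pi.smul_apply, Module.End.mul_apply, seqShift_add_seqMap_pow_apply,
    zero_add]
  rfl

end Shift

/-! ### Binomial convolution of sequences -/

section Convolution

variable {R : Type*} [CommRing R]

/-- The binomial convolution of sequences. -/
def bconv (a b : ℕ → R) (n : ℕ) : R := ∑ k ∈ range (n + 1), n.choose k • (a k * b (n - k))

theorem bconv_zero_index (a b : ℕ → R) : bconv a b 0 = a 0 * b 0 := by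
  simp [bconv]

/-- The index shift is a derivation for the convolution, as differentiation is for products of
exponential generating functions. The inductions below all run on this rule. -/
theorem bconv_succ_index (a b : ℕ → R) (n : ℕ) : bconv a b (n + 1) =
    bconv (fun k => a (k + 1)) b n + bconv a (fun k => b (k + 1)) n := by
  rw [bconv, sum_choose_succ_nsmul (fun i j => a i * b j), add_comm]
  congr 1
  refine sum_congr rfl fun k hk => ?_
  rw [mem_range] at hk
  rw [show n + 1 - k = n - k + 1 by omega]

theorem bconv_add_left (a a' b : ℕ → R) (n : ℕ) :
    bconv (fun k => a k + a' k) b n = bconv a b n + bconv a' b n := by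
  simp only [bconv, add_mul, smul_add, sum_add_distrib]

theorem bconv_add_right (a b b' : ℕ → R) (n : ℕ) :
    bconv a (fun k => b k + b' k) n = bconv a b n + bconv a b' n := by
  simp only [bconv, mul_add, smul_add, sum_add_distrib]

theorem bconv_mul_left (x : R) (a b : ℕ → R) (n : ℕ) :
    bconv (fun k => x * a k) b n = x * bconv a b n := by
  simp only [bconv, mul_assoc, mul_sum, mul_smul_comm]

theorem bconv_mul_right (x : R) (a b : ℕ → R) (n : ℕ) :
    bconv a (fun k => x * b k) n = x * bconv a b n := by
  simp only [bconv, mul_sum, mul_smul_comm, mul_left_comm]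

theorem bconv_comm (a b : ℕ → R) (n : ℕ) : bconv a b n = bconv b a n := by
  induction n generalizing a b with
  | zero => simp only [bconv_zero_index, mul_comm]
  | succ n ih => rw [bconv_succ_index, bconv_succ_index, add_comm, ih, ih (fun k => a (k + 1))]

theorem bconv_assoc (a b c : ℕ → R) (n : ℕ) : bconv (bconv a b) c n = bconv a (bconv b c) n := by
  induction n generalizing a b c with
  | zero => simp only [bconv_zero_index, mul_assoc]
  | succ n ih =>
    rw [bconv_succ_index, bconv_succ_index]
    simp only [bconv_succ_index, bconv_add_left, bconv_add_right, ih, add_assoc]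

/-- The sequence `C(n, r) a_{n-r}`. -/
def lowerSeq (a : ℕ → R) (r n : ℕ) : R := n.choose r • a (n - r)

theorem lowerSeq_zero (a : ℕ → R) (n : ℕ) : lowerSeq a 0 n = a n := by
  simp [lowerSeq]

theorem lowerSeq_eq_zero (a : ℕ → R) {r n : ℕ} (h : n < r) : lowerSeq a r n = 0 := by
  rw [lowerSeq, Nat.choose_eq_zero_of_lt h, zero_smul]

/-- The Leibniz rule for t^{r+1}/(r+1)! times the exponential generating function of `a`. -/
theorem lowerSeq_succ_succ (a : ℕ → R) (r n : ℕ) : lowerSeq a (r + 1) (n + 1) =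
    lowerSeq a r n + lowerSeq (fun k => a (k + 1)) (r + 1) n := by
  rw [lowerSeq, lowerSeq, lowerSeq, Nat.choose_succ_succ, add_smul, Nat.add_sub_add_right]
  congr 1
  rcases lt_or_ge n (r + 1) with h | h
  · rw [Nat.choose_eq_zero_of_lt h, zero_smul, zero_smul]
  · rw [show n - (r + 1) + 1 = n - r by omega]

theorem lowerSeq_add (a b : ℕ → R) (r n : ℕ) :
    lowerSeq (fun k => a k + b k) r n = lowerSeq a r n + lowerSeq b r n := by
  simp only [lowerSeq, smul_add]

theorem lowerSeq_mul (x : R) (a : ℕ → R) (r n : ℕ) :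
    lowerSeq (fun k => x * a k) r n = x * lowerSeq a r n := by
  simp only [lowerSeq, mul_smul_comm]

/-- In exponential generating functions `lowerSeq _ r` is multiplication by t^r/r!, which associates
with the product. -/
theorem bconv_lowerSeq_left (a b : ℕ → R) (r n : ℕ) :
    bconv (lowerSeq a r) b n = lowerSeq (bconv a b) r n := by
  induction n generalizing a b r with
  | zero =>
    cases r <;> simp [bconv_zero_index, lowerSeq]
  | succ n ih =>
    cases r with
    | zero => simp only [funext (lowerSeq_zero a), lowerSeq_zero]
    | succ r =>
      rw [bconv_succ_index, lowerSeq_succ_succ]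
      simp only [lowerSeq_succ_succ, bconv_succ_index, bconv_add_left, lowerSeq_add, ih, add_assoc]

theorem bconv_lowerSeq_right (a b : ℕ → R) (r n : ℕ) :
    bconv a (lowerSeq b r) n = lowerSeq (bconv a b) r n := by
  rw [bconv_comm, bconv_lowerSeq_left]
  exact congrArg _ (bconv_comm b a (n - r))

theorem bconv_pow (x y : R) (n : ℕ) :
    bconv (fun k => x ^ k) (fun k => y ^ k) n = (x + y) ^ n := by
  rw [bconv, add_pow]
  refine sum_congr rfl fun k _ => ?_
  rw [nsmul_eq_mul, mul_comm]

theorem bconv_single (a b : ℕ → R) (hb₀ : b 0 = 1) (hb : ∀ n, b (n + 1) = 0) (n : ℕ) :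
    bconv a b n = a n := by
  rw [bconv, sum_range_succ, sum_eq_zero, Nat.sub_self, hb₀, Nat.choose_self, one_smul, mul_one,
    zero_add]
  intro k hk
  rw [mem_range] at hk
  rw [show n - k = n - k - 1 + 1 by omega, hb, mul_zero, smul_zero]

end Convolution

end Binomial

/-! ### The operators of the φ-row and φ-column, and the calculus of Q_n -/

section LowerOperators

variable {K : Type*} [CommRing K] {ι : Type} {i₀ : ι}

theorem derivation_bconv (D : Derivation ℤ (JetRing K i₀) (JetRing K i₀)) (a b : ℕ → JetRing K i₀)
    (n : ℕ) : D (bconv a b n) = bconv (fun k => D (a k)) b n + bconv a (fun k => D (b k)) n := by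
  simp only [bconv, map_sum, map_nsmul, Derivation.leibniz, smul_eq_mul, smul_add, sum_add_distrib]
  rw [add_comm]
  simp only [mul_comm]

theorem derivation_lowerSeq (D : Derivation ℤ (JetRing K i₀) (JetRing K i₀))
    (a : ℕ → JetRing K i₀) (r n : ℕ) :
    D (lowerSeq a r n) = lowerSeq (fun k => D (a k)) r n := by
  simp only [lowerSeq, map_nsmul]

variable [Differential K]

/-- The operator `∑_s C(n, s+1) a_{n-1-s} ∂^s`. -/
def lowerOp (a : ℕ → JetRing K i₀) (n : ℕ) (v : JetRing K i₀) : JetRing K i₀ :=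
  ∑ s ∈ range n, lowerSeq a (s + 1) n * (del ^ s) v

/-- The operator `∑_s (-∂)^s C(n, s+1) a_{n-1-s}`, the adjoint of `lowerOp`. -/
def lowerAdj (a : ℕ → JetRing K i₀) (n : ℕ) (v : JetRing K i₀) : JetRing K i₀ :=
  ∑ s ∈ range n, ((-del) ^ s : Module.End ℤ (JetRing K i₀)) (lowerSeq a (s + 1) n * v)

/-- The superfluous binomial coefficients vanish, so operators of different index can be summed over
a common range. -/
theorem lowerOp_eq (a : ℕ → JetRing K i₀) {n N : ℕ} (h : n ≤ N) (v : JetRing K i₀) :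
    lowerOp a n v = ∑ s ∈ range N, lowerSeq a (s + 1) n * (del ^ s) v := by
  refine sum_subset (range_subset_range.mpr h) fun s _ hs => ?_
  rw [mem_range, not_lt] at hs
  rw [lowerSeq_eq_zero a (by omega), zero_mul]

theorem lowerAdj_eq (a : ℕ → JetRing K i₀) {n N : ℕ} (h : n ≤ N) (v : JetRing K i₀) :
    lowerAdj a n v =
      ∑ s ∈ range N, ((-del) ^ s : Module.End ℤ (JetRing K i₀)) (lowerSeq a (s + 1) n * v) := by
  refine sum_subset (range_subset_range.mpr h) fun s _ hs => ?_
  rw [mem_range, not_lt] at hs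
  rw [lowerSeq_eq_zero a (by omega), zero_mul, map_zero]

theorem lowerOp_zero (a : ℕ → JetRing K i₀) (n : ℕ) : lowerOp a n 0 = 0 := by
  simp only [lowerOp, map_zero, mul_zero, sum_const_zero]

theorem lowerOp_neg (a : ℕ → JetRing K i₀) (n : ℕ) (v : JetRing K i₀) :
    lowerOp a n (-v) = -lowerOp a n v := by
  simp only [lowerOp, map_neg, mul_neg, sum_neg_distrib]

/-- The coefficients of `lowerOp` are `lowerSeq`, which commutes with convolution; the powers of ∂
stay to the right and do not meet `q`. -/
theorem bconv_lowerOp_left (a q : ℕ → JetRing K i₀) (n : ℕ) (v : JetRing K i₀) :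
    bconv (fun k => lowerOp a k v) q n = lowerOp (bconv a q) n v := by
  rw [bconv, lowerOp]
  simp only [← bconv_lowerSeq_left]
  simp only [bconv, sum_mul]
  rw [sum_comm]
  refine sum_congr rfl fun k hk => ?_
  rw [mem_range] at hk
  rw [lowerOp_eq a (N := n) (by omega), sum_mul, smul_sum]
  refine sum_congr rfl fun s _ => ?_
  rw [smul_mul_assoc, mul_right_comm]

theorem bconv_lowerOp_right (a q : ℕ → JetRing K i₀) (n : ℕ) (v : JetRing K i₀) :
    bconv a (fun k => lowerOp q k v) n = lowerOp (bconv a q) n v := by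
  rw [bconv_comm, bconv_lowerOp_left]
  exact congrArg (fun b => lowerOp b n v) (funext (bconv_comm q a))

/-- The adjoint of `bconv_lowerOp_left`: multiplication by `q` now comes before the powers of -∂. -/
theorem sum_lowerAdj (a q : ℕ → JetRing K i₀) (n : ℕ) (v : JetRing K i₀) :
    ∑ k ∈ range (n + 1), n.choose k • lowerAdj a k (q (n - k) * v) = lowerAdj (bconv a q) n v := by
  rw [lowerAdj]
  simp only [← bconv_lowerSeq_left]
  simp only [bconv, sum_mul, map_sum]
  rw [sum_comm]
  refine sum_congr rfl fun k hk => ?_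
  rw [mem_range] at hk
  rw [lowerAdj_eq a (N := n) (by omega), smul_sum]
  refine sum_congr rfl fun s _ => ?_
  rw [smul_mul_assoc, mul_assoc, map_nsmul]

/-! ### The polynomials `Q_n` -/

theorem Q_zero (w : JetRing K i₀) : Q 0 w = 1 := rfl

theorem Q_succ (n : ℕ) (w : JetRing K i₀) : Q (n + 1) w = totalD (Q n w) + w * Q n w := by
  rw [Q, pow_succ']
  rfl

theorem Q_one (w : JetRing K i₀) : Q 1 w = w := by
  rw [Q_succ, Q_zero, Derivation.map_one_eq_zero, zero_add, mul_one]

/-- Both ∂ and the index shift are derivations of the convolution, so the right side obeys the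
recursion of Q_n with ∂ + w + w'. -/
theorem Q_add (n : ℕ) (w w' : JetRing K i₀) :
    Q n (w + w') = bconv (fun k => Q k w) (fun k => Q k w') n := by
  induction n with
  | zero => simp [bconv_zero_index, Q_zero]
  | succ n ih =>
    rw [Q_succ, ih, bconv_succ_index, derivation_bconv]
    simp only [Q_succ, bconv_add_left, bconv_add_right, bconv_mul_left, bconv_mul_right]
    ring

theorem Q_succ_zero (n : ℕ) : Q (n + 1) (0 : JetRing K i₀) = 0 := by
  induction n with
  | zero => exact Q_one 0
  | succ n ih => rw [Q_succ, ih, map_zero, zero_mul, add_zero]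

theorem bconv_Q_zero (a : ℕ → JetRing K i₀) (n : ℕ) : bconv a (fun k => Q k 0) n = a n :=
  bconv_single a _ (Q_zero 0) Q_succ_zero n

theorem diffHom_Q {κ : Type} {k₀ : κ} (g : ι → JetRing K k₀) (hg : IsUnit (g i₀)) (n : ℕ)
    (w : JetRing K i₀) :
    (diffHom g hg : JetRing K i₀ →ₐ[K] JetRing K k₀) (Q n w) = Q n (diffHom g hg w) := by
  induction n with
  | zero => simp [Q_zero]
  | succ n ih => rw [Q_succ, map_add, map_mul, diffHom_totalD, ih, Q_succ]

/-- Induction along Q_{n+1} = ∂Q_n + wQ_n. The Pascal term comes from differentiating the factor w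
when j = 0, and from the commutator with ∂ when j > 0. The constant `d` serves w = u with d = 1, w =
λφ with d = λ, and variables absent from w with d = 0. -/
theorem partialD_Q {l : ι} {w d : JetRing K i₀} (hd : totalD d = 0) (h₀ : partialD (l, 0) w = d)
    (h : ∀ j, partialD (l, j + 1) w = 0) (n j : ℕ) :
    partialD (l, j) (Q n w) = d * lowerSeq (fun k => Q k w) (j + 1) n := by
  induction n generalizing j with
  | zero =>
    rw [Q_zero, Derivation.map_one_eq_zero, lowerSeq_eq_zero _ (by omega), mul_zero]
  | succ n ih =>
    rw [Q_succ, map_add, Derivation.leibniz, smul_eq_mul, smul_eq_mul, ih, lowerSeq_succ_succ]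
    simp only [Q_succ, lowerSeq_add, lowerSeq_mul]
    cases j with
    | zero =>
      rw [partialD_zero_totalD, ih, Derivation.leibniz, hd, derivation_lowerSeq, h₀,
        lowerSeq_zero, smul_eq_mul, smul_zero]
      ring
    | succ j =>
      rw [partialD_succ_totalD, ih, ih, Derivation.leibniz, hd, derivation_lowerSeq, h,
        smul_eq_mul, smul_zero]
      ring

/-- The Fréchet derivative of Q_n, for a field commuting with ∂. Its coefficients are the partial
derivatives found in `partialD_Q`. -/
theorem derivation_Q {X : Derivation ℤ (JetRing K i₀) (JetRing K i₀)}
    (hX : ∀ f, X (totalD f) = totalD (X f)) (n : ℕ) (w : JetRing K i₀) :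
    X (Q n w) = lowerOp (fun k => Q k w) n (X w) := by
  induction n with
  | zero => rw [Q_zero, Derivation.map_one_eq_zero, lowerOp, sum_range_zero]
  | succ n ih =>
    rw [Q_succ, map_add, Derivation.leibniz, hX, ih]
    conv_rhs => rw [lowerOp]
    simp only [lowerSeq_succ_succ, Q_succ, lowerSeq_add, lowerSeq_mul, add_mul, sum_add_distrib]
    -- The Pascal half of the sum begins with Q_n X(w), from differentiating w; its other terms are
    -- those where ∂ raises the order of X(w). The top terms s = n of the remaining sums vanish.
    rw [sum_range_succ', lowerSeq_zero, del_pow_zero_apply]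
    rw [sum_range_succ (fun s => lowerSeq (fun k => totalD (Q k w)) (s + 1) n * (del ^ s) (X w)),
      lowerSeq_eq_zero _ (Nat.lt_succ_self n), zero_mul]
    rw [sum_range_succ (fun s => w * lowerSeq (fun k => Q k w) (s + 1) n * (del ^ s) (X w)),
      lowerSeq_eq_zero _ (Nat.lt_succ_self n), mul_zero, zero_mul, lowerOp, map_sum]
    simp only [Derivation.leibniz, derivation_lowerSeq, smul_eq_mul, ← del_pow_succ_apply,
      sum_add_distrib, mul_sum, mul_assoc, mul_comm (lowerSeq (fun k => totalD (Q k w)) _ n)]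
    ring

end LowerOperators

/-! ### Expansions of (∂ + w)^n and the transformation of the KP block -/

section Expansions

variable {K : Type*} [CommRing K] {ι : Type} {i₀ : ι}

theorem mulOp_one : (mulOp 1 : Module.End ℤ (JetRing K i₀)) = 1 := by
  ext x
  exact one_mul x

variable [Differential K]

/-- The commutation relation needed by `mul_add_pow_eq_sum` with T = -∂; it restates Q_{j+1} = ∂Q_j
+ wQ_j. -/
theorem mulOp_Q_comm (w : JetRing K i₀) (j : ℕ) :
    mulOp (Q j w) * (-del + mulOp w) = -del * mulOp (Q j w) + mulOp (Q (j + 1) w) := by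
  ext x
  simp only [Module.End.mul_apply, LinearMap.add_apply, LinearMap.neg_apply, del_apply,
    mulOp_apply, Derivation.leibniz, smul_eq_mul, Q_succ]
  ring

theorem mul_mulOp_Q_comm (w : JetRing K i₀) (j : ℕ) :
    (del + mulOp w) * mulOp (Q j w) = mulOp (Q j w) * del + mulOp (Q (j + 1) w) := by
  ext x
  simp only [Module.End.mul_apply, LinearMap.add_apply, del_apply,
    mulOp_apply, Derivation.leibniz, smul_eq_mul, Q_succ]
  ring

theorem del_add_pow_apply (w x : JetRing K i₀) (n m : ℕ) :
    ((del + mulOp w) ^ n : Module.End ℤ (JetRing K i₀)) (Q m w * x) =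
      ∑ μ ∈ range (n + 1), n.choose μ • (Q (n + m - μ) w * (del ^ μ) x) := by
  have h := LinearMap.congr_fun (add_pow_mul_eq_sum del (mulOp w) (fun j => mulOp (Q j w))
    (mul_mulOp_Q_comm w) m n) x
  rw [Module.End.mul_apply, mulOp_apply, LinearMap.sum_apply] at h
  rw [h]
  refine sum_congr rfl fun μ hμ => ?_
  rw [mem_range] at hμ
  rw [LinearMap.smul_apply, Module.End.mul_apply, mulOp_apply,
    show m + (n - μ) = n + m - μ by omega]

theorem neg_del_add_pow_apply (w x : JetRing K i₀) (n m : ℕ) :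
    Q n w * ((-del + mulOp w) ^ m : Module.End ℤ (JetRing K i₀)) x =
      ∑ μ ∈ range (m + 1), m.choose μ • ((-del) ^ μ : Module.End ℤ (JetRing K i₀))
        (Q (n + m - μ) w * x) := by
  have h := LinearMap.congr_fun (mul_add_pow_eq_sum (-del) (mulOp w) (fun j => mulOp (Q j w))
    (mulOp_Q_comm w) n m) x
  rw [Module.End.mul_apply, mulOp_apply, LinearMap.sum_apply] at h
  rw [h]
  refine sum_congr rfl fun μ hμ => ?_
  rw [mem_range] at hμ
  rw [LinearMap.smul_apply, Module.End.mul_apply, mulOp_apply,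
    show n + (m - μ) = n + m - μ by omega]

/-- In the expansion of (∂ + w)^n the term free of ∂ is Q_n, and the rest has a factor ∂ on the
right. -/
theorem lowerOp_Q_totalD (w x : JetRing K i₀) (n : ℕ) :
    lowerOp (fun k => Q k w) n (totalD x) =
      ((del + mulOp w) ^ n : Module.End ℤ (JetRing K i₀)) x - Q n w * x := by
  have h := del_add_pow_apply w x n 0
  rw [Q_zero, one_mul] at h
  rw [h, sum_range_succ', Nat.choose_zero_right, one_smul, add_zero, Nat.sub_zero,
    del_pow_zero_apply, add_sub_cancel_right, lowerOp]
  refine sum_congr rfl fun s _ => ?_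
  rw [lowerSeq, smul_mul_assoc, pow_succ]
  rfl

/-- The adjoint identity, with ∂ factored out on the left; the sign comes from (-∂)^{s+1}. -/
theorem totalD_lowerAdj_Q (w x : JetRing K i₀) (m : ℕ) :
    totalD (lowerAdj (fun k => Q k w) m x) =
      Q m w * x - ((-del + mulOp w) ^ m : Module.End ℤ (JetRing K i₀)) x := by
  have h := neg_del_add_pow_apply w x 0 m
  rw [Q_zero, one_mul] at h
  rw [h, sum_range_succ', Nat.choose_zero_right, one_smul, zero_add, Nat.sub_zero, pow_zero,
    Module.End.one_apply, sub_add_cancel_right, lowerAdj, map_sum, ← sum_neg_distrib]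
  refine sum_congr rfl fun s _ => ?_
  rw [lowerSeq, smul_mul_assoc, map_nsmul, map_nsmul, pow_succ', ← smul_neg]
  congr 1
  exact (neg_neg _).symm

theorem mulRight_del_pow_apply (μ : ℕ) (P : Module.End ℤ (JetRing K i₀)) :
    ((LinearMap.mulRight ℤ del) ^ μ : Module.End ℤ (Module.End ℤ (JetRing K i₀))) P =
      P * del ^ μ := by
  rw [LinearMap.pow_mulRight, LinearMap.mulRight_apply]

/-- This handles the half of the KP block with ∂^μ on the right, by `sum_binomTransform` for
operator-valued sequences with T equal to right multiplication by ∂. -/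
theorem sum_bconv_mul_del_pow (a : ℕ → JetRing K i₀) (w F : JetRing K i₀) (n m : ℕ) :
    ∑ μ ∈ range (n + 1), n.choose μ • (bconv a (fun k => Q k w) (n + m - μ) * (del ^ μ) F) =
      ∑ k ∈ range (n + 1), n.choose k • ((∑ l ∈ range (m + 1), m.choose l •
        ∑ μ ∈ range (k + 1), k.choose μ • (a (k + l - μ) * (del ^ μ) (Q (m - l) w * F))) *
          Q (n - k) w) := by
  -- Right multiplication reverses the order of the factors, so `n` and `m` trade places and the
  -- relation for ∂ + w is the one required.
  have h := LinearMap.congr_fun (sum_binomTransform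
    (LinearMap.mulRight ℤ (del : Module.End ℤ (JetRing K i₀))) (LinearMap.mulRight ℤ (mulOp w))
    (fun j => LinearMap.mulRight ℤ (mulOp (Q j w)))
    (by
      ext1 P
      rw [Q_zero, mulOp_one, LinearMap.mulRight_apply, mul_one]
      rfl)
    (fun j => by
      ext1 P
      simp only [Module.End.mul_apply, LinearMap.add_apply, LinearMap.mulRight_apply]
      rw [← mul_add, mul_assoc, mul_mulOp_Q_comm, mul_add, mul_assoc])
    (fun k => mulOp (a k)) m n) F
  simp only [mulRight_del_pow_apply, LinearMap.mulRight_apply, LinearMap.sum_apply,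
    LinearMap.smul_apply, Module.End.mul_apply, binomTransform_apply, mulOp_apply,
    smul_sum, sum_mul] at h
  simp only [bconv, smul_sum, sum_mul]
  rw [sum_comm (s := range (n + 1)) (t := range (m + 1))]
  convert h using 1
  · refine sum_congr rfl fun μ hμ => ?_
    rw [mem_range] at hμ
    rw [show m + (n - μ) = n + m - μ by omega]
    refine sum_congr rfl fun k _ => ?_
    rw [smul_mul_assoc, mul_assoc]
  · refine sum_congr rfl fun l _ => sum_congr rfl fun k _ => sum_congr rfl fun μ hμ => ?_
    rw [mem_range] at hμ
    rw [show l + (k - μ) = k + l - μ by omega]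
    simp only [smul_mul_assoc]
    rw [smul_comm (n.choose k), mul_right_comm, mul_assoc]

/-- The adjoint half of the KP block: here T = -∂ acts directly on the sequence a_k F. -/
theorem sum_neg_del_pow_bconv (a : ℕ → JetRing K i₀) (w F : JetRing K i₀) (n m : ℕ) :
    ∑ μ ∈ range (m + 1), m.choose μ • ((-del) ^ μ : Module.End ℤ (JetRing K i₀))
        (bconv a (fun k => Q k w) (n + m - μ) * F) =
      ∑ k ∈ range (n + 1), n.choose k • ((∑ l ∈ range (m + 1), m.choose l •
        ∑ μ ∈ range (l + 1), l.choose μ • ((-del) ^ μ : Module.End ℤ (JetRing K i₀))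
          (a (k + l - μ) * (Q (m - l) w * F))) * Q (n - k) w) := by
  have h := sum_binomTransform (-del) (mulOp w) (fun j => mulOp (Q j w))
    (by rw [Q_zero, mulOp_one]) (mulOp_Q_comm w) (fun k => a k * F) n m
  convert h using 1
  · refine sum_congr rfl fun μ hμ => ?_
    rw [mem_range] at hμ
    rw [show n + (m - μ) = n + m - μ by omega, bconv, binomTransform_apply, sum_mul]
    congr 2
    refine sum_congr rfl fun k _ => ?_
    rw [mulOp_apply, smul_mul_assoc, mul_right_comm, mul_comm]
  · refine sum_congr rfl fun k _ => ?_
    rw [mulOp_apply, mul_comm]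
    congr 2
    refine sum_congr rfl fun l _ => ?_
    congr 1
    refine sum_congr rfl fun μ hμ => ?_
    rw [mem_range] at hμ
    rw [show k + (l - μ) = k + l - μ by omega, mulOp_apply, mul_left_comm]

end Expansions

/-! ### Sums over the two index types -/

section Indices

theorem finsum_waveIdx {M : Type*} [AddCommMonoid M] (f : WaveIdx → M) :
    ∑ᶠ l, f l = f .u + f .h + f .phi := by
  classical
  rw [finsum_eq_sum_of_support_subset (s := {.u, .h, .phi})]
  · rw [sum_insert (by simp), sum_insert (by simp), sum_singleton, add_assoc]
  · intro l _
    cases l <;> simp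

theorem finsum_momentIdx {M : Type*} [AddCommMonoid M] (f : MomentIdx → M) (N : ℕ)
    (hN : ∀ l, N ≤ l → f (.A l) = 0) : ∑ᶠ l, f l = ∑ l ∈ range N, f (.A l) + f .phi := by
  classical
  rw [finsum_eq_sum_of_support_subset (s := insert .phi ((range N).image .A))]
  · rw [sum_insert (by simp), sum_image (fun a _ b _ h => by injection h), add_comm]
  · intro l hl
    cases l with
    | phi => simp
    | A l =>
      simp only [coe_insert, coe_image, coe_range, Set.mem_insert_iff, reduceCtorEq,
        Set.mem_image, Set.mem_Iio, MomentIdx.A.injEq, exists_eq_right, false_or]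
      by_contra h
      exact hl (hN l (not_lt.mp h))

end Indices

/-! ### The matrices applied to elements -/

section Matrices

variable {K : Type*} [CommRing K] [Differential K]

theorem diffHom_varInv {ι κ : Type} {i₀ : ι} {k₀ : κ} (g : ι → JetRing K k₀) (hg : IsUnit (g i₀))
    (h : g i₀ = var k₀) : (diffHom g hg : JetRing K i₀ →ₐ[K] JetRing K k₀) varInv = varInv := by
  apply hg.mul_left_cancel
  rw [h, var_mul_varInv]
  rw [← h, ← diffHom_var g hg, ← map_mul, var_mul_varInv, map_one]

/-- Each half of the entry is cut to its own range, beyond which the binomial coefficients vanish.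
-/
theorem kpMatrix_A_A (n m : ℕ) (v : MomentRing K) : kpMatrix (.A n) (.A m) v =
    ∑ μ ∈ range (n + 1), n.choose μ • (A (n + m - μ) * (del ^ μ) v) -
      ∑ μ ∈ range (m + 1), m.choose μ • ((-del) ^ μ : Module.End ℤ (MomentRing K))
        (A (n + m - μ) * v) := by
  have h : ∀ (n N : ℕ) (f : ℕ → MomentRing K), n ≤ N →
      ∑ μ ∈ range (N + 1), n.choose μ • f μ = ∑ μ ∈ range (n + 1), n.choose μ • f μ := by
    intro n N f hN
    refine (sum_subset (range_subset_range.mpr (by omega)) fun s _ hs => ?_).symm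
    rw [mem_range, not_lt] at hs
    rw [Nat.choose_eq_zero_of_lt (by omega), zero_smul]
  rw [← h n (n + m) _ (by omega), ← h m (n + m) _ (by omega), ← sum_sub_distrib, kpMatrix,
    LinearMap.sum_apply]
  rfl

theorem lowerSeq_succ_eq {R : Type*} [CommRing R] (a : ℕ → R) (s n : ℕ) :
    lowerSeq a (s + 1) n = n.choose (s + 1) • a (n - 1 - s) := by
  rw [lowerSeq, Nat.sub_sub, add_comm 1 s]

theorem kpMatrix_phi_A (m : ℕ) (v : MomentRing K) :
    kpMatrix .phi (.A m) v = varInv * totalD phi * lowerAdj A m v := by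
  rw [kpMatrix, Module.End.mul_apply, mulOp_apply, LinearMap.sum_apply, lowerAdj]
  congr 1
  refine sum_congr rfl fun s _ => ?_
  rw [LinearMap.smul_apply, lowerSeq_succ_eq, smul_mul_assoc, map_nsmul]
  rfl

theorem kpMatrix_A_phi (n : ℕ) (v : MomentRing K) :
    kpMatrix (.A n) .phi v = -lowerOp A n (varInv * totalD phi * v) := by
  rw [kpMatrix, LinearMap.neg_apply, Module.End.mul_apply, mulOp_apply, LinearMap.sum_apply,
    lowerOp]
  congr 1
  refine sum_congr rfl fun s _ => ?_
  rw [LinearMap.smul_apply, lowerSeq_succ_eq, smul_mul_assoc]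
  rfl

theorem waveMatrix_u_apply (z : WaveIdx → WaveRing K) :
    ∑ᶠ l, waveMatrix .u l (z l) = totalD (z .h) - totalD wphi * varInv * z .phi := by
  rw [finsum_waveIdx, waveMatrix, waveMatrix, waveMatrix, LinearMap.zero_apply, zero_add,
    LinearMap.neg_apply, ← sub_eq_add_neg]
  · rfl
  -- What remains is that the entry given by the catch-all case is none of the listed ones.
  all_goals simp

theorem waveMatrix_h_apply (z : WaveIdx → WaveRing K) :
    ∑ᶠ l, waveMatrix .h l (z l) = totalD (z .u) := by
  rw [finsum_waveIdx, waveMatrix, waveMatrix, waveMatrix, LinearMap.zero_apply, add_zero,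
    LinearMap.zero_apply, add_zero]
  · rfl
  all_goals simp

theorem waveMatrix_phi_apply (z : WaveIdx → WaveRing K) :
    ∑ᶠ l, waveMatrix .phi l (z l) = totalD wphi * varInv * z .u := by
  rw [finsum_waveIdx, waveMatrix, waveMatrix, waveMatrix, LinearMap.zero_apply, add_zero,
    LinearMap.zero_apply, add_zero]
  · rfl
  all_goals simp

end Matrices

/-! ### Partial derivatives and adjoint Fréchet derivatives of simple elements -/

section PartialDerivatives

variable {K : Type*} [CommRing K] {ι : Type} {i₀ : ι}

theorem partialD_mul_of_right {w : ι × ℕ} {a b : JetRing K i₀}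
    (h : partialD w a = 0) : partialD w (a * b) = a * partialD w b := by
  rw [Derivation.leibniz, h, smul_zero, add_zero, smul_eq_mul]

theorem partialD_mul_of_left {w : ι × ℕ} {a b : JetRing K i₀}
    (h : partialD w b = 0) : partialD w (a * b) = b * partialD w a := by
  rw [Derivation.leibniz, h, smul_zero, zero_add, smul_eq_mul]

theorem partialD_var_self (i : ι) : partialD (i, 0) (var i : JetRing K i₀) = 1 := by
  rw [var, partialD_jet, if_pos rfl]

theorem partialD_var_ne {i l : ι} (h : i ≠ l) (j : ℕ) :
    partialD (l, j) (var i : JetRing K i₀) = 0 := by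
  rw [var, partialD_jet, if_neg (fun h' => h (Prod.mk.inj h').1)]

theorem partialD_succ_var (i l : ι) (j : ℕ) :
    partialD (l, j + 1) (var i : JetRing K i₀) = 0 := by
  rw [var, partialD_jet, if_neg (fun h' => by simp at h')]

variable [Differential K]

theorem adjFrechet_order_zero {l : ι} {G : JetRing K i₀}
    (h : ∀ j, partialD (l, j + 1) G = 0) (F : JetRing K i₀) :
    adjFrechet l G F = F * partialD (l, 0) G := by
  rw [adjFrechet_eq_sum l G F 1, sum_range_one, pow_zero, Module.End.one_apply]
  intro j hj
  obtain ⟨j, rfl⟩ : ∃ k, j = k + 1 := ⟨j - 1, by omega⟩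
  exact h j

theorem adjFrechet_var_self (i : ι) (F : JetRing K i₀) : adjFrechet i (var i) F = F := by
  rw [adjFrechet_order_zero (partialD_succ_var i i), partialD_var_self, mul_one]

theorem adjFrechet_var_ne {i l : ι} (h : i ≠ l) (F : JetRing K i₀) :
    adjFrechet l (var i) F = 0 :=
  adjFrechet_eq_zero _ _ _ (partialD_var_ne h)

theorem adjFrechet_lowerSeq {l : ι} {a : ℕ → JetRing K i₀} {d G : JetRing K i₀} {n : ℕ}
    (h : ∀ j, partialD (l, j) G = d * lowerSeq a (j + 1) n) (F : JetRing K i₀) :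
    adjFrechet l G F = lowerAdj a n (d * F) := by
  rw [adjFrechet_eq_sum l G F n]
  · refine sum_congr rfl fun j _ => congrArg _ ?_
    rw [h]
    ring
  · intro j hj
    rw [h, lowerSeq_eq_zero _ (by omega), mul_zero]

end PartialDerivatives

/-! ### The (u, h, φ)-space and its shift -/

section Wave

variable {K : Type*} [CommRing K]

theorem isUnit_waveShiftVal (c : K) : IsUnit (waveShiftVal c .h) := isUnit_var

variable [Differential K]

theorem waveShift_eq (c : K) : waveShift c = diffHom (waveShiftVal c) (isUnit_waveShiftVal c) := rfl

/-- Of the nine entries only uu needs a cancellation: u + λφ pairs B_{uφ} and B_{φu} with the same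
factor λ, and these entries are opposite multiplications. -/
theorem isHamiltonianMap_waveShift (c : K) :
    IsHamiltonianMap (waveMatrix (K := K)) waveMatrix (waveShift c) := by
  have hu : ∀ l F, adjFrechet l (wu + c • wphi : WaveRing K) F =
      adjFrechet l wu F + c • adjFrechet l wphi F := by
    intro l F
    rw [adjFrechet_order_zero, adjFrechet_order_zero, adjFrechet_order_zero, map_add, partialD_smul,
      mul_add, mul_smul_comm]
    · exact partialD_succ_var _ _
    · exact partialD_succ_var _ _
    · intro j
      rw [map_add, partialD_smul, wu, wphi, partialD_succ_var, partialD_succ_var, smul_zero,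
        add_zero]
  rw [waveShift_eq]
  apply isHamiltonianMap_diffHom
  intro i m v
  have hinv : diffHom (waveShiftVal c) (isUnit_waveShiftVal c) (varInv : WaveRing K) = varInv :=
    diffHom_varInv _ _ rfl
  have hphi : diffHom (waveShiftVal c) (isUnit_waveShiftVal c) (totalD wphi : WaveRing K) = totalD wphi := by
    rw [diffHom_totalD, wphi, diffHom_var]
    rfl
  set Φ : WaveRing K →ₐ[K] WaveRing K := diffHom (waveShiftVal c) (isUnit_waveShiftVal c) with hΦ
  have hd : ∀ f, Φ (del f) = totalD (Φ f) := diffHom_totalD _ _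
  have e : ∀ (Z : WaveIdx → WaveRing K) l, evolution Z (waveShiftVal c l) =
      match l with
      | .u => Z .u + c • Z .phi
      | .h => Z .h
      | .phi => Z .phi := by
    intro Z l
    cases l with
    | u => rw [waveShiftVal, map_add, evolution_smul, wu, wphi, evolution_var, evolution_var]
    | h => exact evolution_var Z _
    | phi => exact evolution_var Z _
  rw [e]
  have a1 : ∀ F : WaveRing K, adjFrechet .u wu F = F := adjFrechet_var_self _
  have a2 : ∀ F : WaveRing K, adjFrechet .h wh F = F := adjFrechet_var_self _
  have a3 : ∀ F : WaveRing K, adjFrechet .phi wphi F = F := adjFrechet_var_self _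
  have a4 : ∀ F : WaveRing K, adjFrechet .h wu F = 0 := adjFrechet_var_ne (by simp)
  have a5 : ∀ F : WaveRing K, adjFrechet .phi wu F = 0 := adjFrechet_var_ne (by simp)
  have a6 : ∀ F : WaveRing K, adjFrechet .u wh F = 0 := adjFrechet_var_ne (by simp)
  have a7 : ∀ F : WaveRing K, adjFrechet .phi wh F = 0 := adjFrechet_var_ne (by simp)
  have a8 : ∀ F : WaveRing K, adjFrechet .u wphi F = 0 := adjFrechet_var_ne (by simp)
  have a9 : ∀ F : WaveRing K, adjFrechet .h wphi F = 0 := adjFrechet_var_ne (by simp)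
  cases i <;> cases m <;>
    simp only [waveShiftVal, waveMatrix_u_apply, waveMatrix_h_apply, waveMatrix_phi_apply, hu, a1,
      a2, a3, a4, a5, a6, a7, a8, a9] <;>
    simp only [waveMatrix, LinearMap.zero_apply, map_zero, smul_zero,
      add_zero, zero_add, mul_zero, sub_zero, zero_sub, hd, LinearMap.neg_apply, mulOp_apply,
      map_neg, map_mul, hinv, hphi, mul_smul_comm, neg_add_cancel]

theorem waveShift_comp (c d : K) :
    (waveShift c).comp (waveShift d) = (waveShift (d + c) : WaveRing K →ₐ[K] WaveRing K) := by
  apply diffHom_ext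
  · intro f
    rw [AlgHom.comp_apply, AlgHom.comp_apply, waveShift_eq, waveShift_eq, diffHom_totalD,
      diffHom_totalD]
  · intro f
    rw [waveShift_eq, diffHom_totalD]
  · intro i
    have h1 : ∀ c : K, waveShift c (wphi : WaveRing K) = wphi := fun c => diffHom_var _ _ _
    have h2 : ∀ c : K, waveShift c (wu : WaveRing K) = wu + c • wphi := fun c => diffHom_var _ _ _
    have h3 : ∀ c : K, waveShift c (wh : WaveRing K) = wh := fun c => diffHom_var _ _ _
    cases i with
    | u =>
      change waveShift c (waveShift d wu) = waveShift (d + c) wu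
      rw [h2, h2, map_add, h2, map_smul, h1, add_smul]
      ring
    | h =>
      change waveShift c (waveShift d wh) = waveShift (d + c) wh
      rw [h3, h3, h3]
    | phi =>
      change waveShift c (waveShift d wphi) = waveShift (d + c) wphi
      rw [h1, h1, h1]

theorem waveShift_zero : (waveShift 0 : WaveRing K →ₐ[K] WaveRing K) = AlgHom.id K _ := by
  apply diffHom_ext
  · intro f
    rw [waveShift_eq, diffHom_totalD]
  · intro f
    rfl
  · intro i
    rw [waveShift_eq, diffHom_var]
    cases i <;> simp [waveShiftVal, wu, wh, wphi]

theorem isHamiltonianAut_waveShift (c : K) :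
    IsHamiltonianAut (waveMatrix (K := K)) (waveShift c) :=
  isHamiltonianAut_of_inverse (isHamiltonianMap_waveShift c)
    (Ψ := waveShift (-c)) (by rw [waveShift_comp, neg_add_cancel, waveShift_zero])
    (by rw [waveShift_comp, add_neg_cancel, waveShift_zero])

/-- A differential homomorphism from the moments space to the `(u, h, φ)`-space that takes
`A_0, A_1, φ` to `h, h u, φ` is surjective. -/
theorem surjective_of_var (g : MomentIdx → WaveRing K) (hg : IsUnit (g (.A 0)))
    (h₀ : g (.A 0) = wh) (h₁ : g (.A 1) = wh * wu) (hphi : g .phi = wphi) :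
    Function.Surjective (diffHom g hg : MomentRing K →ₐ[K] WaveRing K) := by
  set R : MomentRing K →ₐ[K] WaveRing K := diffHom g hg with hR
  -- A right inverse: u is recovered as A_1 / A_0.
  let s : WaveIdx → MomentRing K
    | .u => A 1 * varInv
    | .h => A 0
    | .phi => phi
  have hs : IsUnit (s .h) := isUnit_var
  set S : WaveRing K →ₐ[K] MomentRing K := diffHom s hs with hS
  have hRS : R.comp S = AlgHom.id K _ := by
    apply diffHom_ext
    · intro f
      rw [AlgHom.comp_apply, AlgHom.comp_apply, hS, diffHom_totalD, hR, diffHom_totalD]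
    · intro f
      rfl
    · intro i
      rw [AlgHom.comp_apply, hS, diffHom_var, AlgHom.id_apply]
      cases i with
      | u =>
        change R (A 1 * varInv) = wu
        rw [map_mul, hR, A, diffHom_var, diffHom_varInv _ _ h₀, h₁, mul_right_comm, wh,
          var_mul_varInv, one_mul]
      | h => exact (diffHom_var g hg _).trans h₀
      | phi => exact (diffHom_var g hg _).trans hphi
  exact fun f => ⟨S f, DFunLike.congr_fun hRS f⟩

end Wave

/-! ### The reduction A_n = h Q_n(u) -/

section KPReduction

variable {K : Type*} [CommRing K] [Differential K]

/-- The u-part of the Fréchet derivative of h Q_n is h times `lowerOp`, the h-part is multiplication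
by Q_n. Since B_{uh} = B_{hu} = ∂, the operators `lowerOp` and `lowerAdj` occur next to ∂, where
they are differences of powers of ±∂ + u and Q's. The φ-entries match because R(A_0) = h. -/
theorem isHamiltonianMap_kpReduction :
    IsHamiltonianMap (kpMatrix (K := K)) waveMatrix kpReduction := by
  have wu_ne : ∀ l, l ≠ .u → ∀ j, partialD (l, j) (wu : WaveRing K) = 0 :=
    fun l hl j => partialD_var_ne hl.symm j
  have wu_self : partialD (.u, 0) (wu : WaveRing K) = 1 := partialD_var_self _
  have wu_succ : ∀ l j, partialD (l, j + 1) (wu : WaveRing K) = 0 := partialD_succ_var _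
  have wh_u : ∀ j, partialD (.u, j) (wh : WaveRing K) = 0 := partialD_var_ne (by simp)
  have hu0 : ∀ l, l ≠ .u → ∀ n j, partialD (l, j) (Q n (wu : WaveRing K)) = 0 := by
    intro l hl n j
    rw [partialD_Q (d := 0) (map_zero _) (wu_ne l hl 0) (wu_succ l),
      zero_mul]
  have a1 : ∀ n (F : WaveRing K), adjFrechet .u (wh * Q n wu) F =
      lowerAdj (fun k => Q k wu) n (wh * F) := by
    intro n F
    apply adjFrechet_lowerSeq
    intro j
    rw [partialD_mul_of_right (wh_u j), partialD_Q (d := 1)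
      (Derivation.map_one_eq_zero _) wu_self (wu_succ _), one_mul]
  have a2 : ∀ n (F : WaveRing K), adjFrechet .h (wh * Q n wu) F = Q n wu * F := by
    intro n F
    rw [adjFrechet_order_zero, partialD_mul_of_left (hu0 _ (by simp) _ _), wh, partialD_var_self,
      mul_one, mul_comm]
    intro j
    rw [partialD_mul_of_left (hu0 _ (by simp) _ _), wh, partialD_succ_var, mul_zero]
  have a3 : ∀ n (F : WaveRing K), adjFrechet .phi (wh * Q n wu) F = 0 := by
    intro n F
    apply adjFrechet_eq_zero
    intro j
    rw [partialD_mul_of_left (hu0 _ (by simp) _ _), wh, partialD_var_ne (by simp), mul_zero]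
  have a4 : ∀ F : WaveRing K, adjFrechet .phi wphi F = F := adjFrechet_var_self _
  have a5 : ∀ F : WaveRing K, adjFrechet .u wphi F = 0 := adjFrechet_var_ne (by simp)
  have a6 : ∀ F : WaveRing K, adjFrechet .h wphi F = 0 := adjFrechet_var_ne (by simp)
  have e1 : ∀ (Z : WaveIdx → WaveRing K) n, evolution Z (wh * Q n wu) =
      Q n wu * Z .h + wh * lowerOp (fun k => Q k wu) n (Z .u) := by
    intro Z n
    rw [Derivation.leibniz, derivation_Q (evolution_totalD Z), wu, wh, evolution_var,
      evolution_var, smul_eq_mul, smul_eq_mul, add_comm]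
  have e2 : ∀ Z : WaveIdx → WaveRing K, evolution Z wphi = Z .phi := fun Z => evolution_var Z _
  apply isHamiltonianMap_diffHom
  intro i m v
  set R : MomentRing K →ₐ[K] WaveRing K := diffHom kpReductionVal _ with hR
  have hA : ∀ n, R (A n) = wh * Q n wu := fun n => diffHom_var _ _ _
  have hinv : R varInv = varInv := diffHom_varInv _ _ (by simp [kpReductionVal, Q_zero, wh])
  have hphi : R (totalD phi) = totalD wphi := by
    rw [hR, diffHom_totalD, phi, diffHom_var]
    rfl
  have hdel : ∀ j f, R ((del ^ j) f) = (del ^ j) (R f) := diffHom_del_pow _ _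
  have hneg : ∀ j f, R (((-del) ^ j) f) = ((-del) ^ j) (R f) := diffHom_neg_del_pow _ _
  have hop : ∀ n f, R (lowerOp A n f) = wh * lowerOp (fun k => Q k wu) n (R f) := by
    intro n f
    simp only [lowerOp, lowerSeq, map_sum, map_mul, map_nsmul, hA, hdel, mul_sum]
    exact sum_congr rfl fun s _ => by rw [← mul_smul_comm, mul_assoc]
  have hadj : ∀ n f, R (lowerAdj A n f) = lowerAdj (fun k => Q k wu) n (wh * R f) := by
    intro n f
    simp only [lowerAdj, lowerSeq, map_sum, hneg, map_mul, map_nsmul, hA]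
    exact sum_congr rfl fun s _ => by rw [← mul_smul_comm, mul_left_comm, mul_assoc]
  cases i with
  | A n =>
    cases m with
    | A m =>
      simp only [kpReductionVal, e1, waveMatrix_u_apply, waveMatrix_h_apply, a1, a2, a3, mul_zero,
        sub_zero]
      rw [lowerOp_Q_totalD, totalD_lowerAdj_Q, del_add_pow_apply, mul_sub, mul_sub,
        neg_del_add_pow_apply, kpMatrix_A_A, map_sub, map_sum, map_sum]
      simp only [map_nsmul, map_mul, hA, hdel, hneg, mul_sum, mul_smul_comm]
      -- The terms `x` and `t` are the same product h Q_n Q_m R(v), once from each half, and cancel.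
      rw [show ∀ x y z t : WaveRing K, x - y + (z - t) = z - y + (x - t) by intros; ring]
      rw [show Q n wu * (Q m wu * (wh * R v)) = wh * (Q n wu * (Q m wu * R v)) by ring, sub_self,
        add_zero]
      simp only [mul_assoc, mul_left_comm wh]
    | phi =>
      simp only [kpReductionVal, e1, waveMatrix_u_apply, waveMatrix_h_apply, a4, a5, a6, map_zero,
        mul_zero, zero_add, zero_sub]
      rw [kpMatrix_A_phi, map_neg, hop, map_mul, map_mul, hinv, hphi]
      simp only [lowerOp, map_neg, mul_neg, sum_neg_distrib]
      simp only [mul_comm]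
  | phi =>
    cases m with
    | A m =>
      simp only [kpReductionVal, e2, waveMatrix_phi_apply, a1]
      rw [kpMatrix_phi_A, map_mul, map_mul, hadj, hinv, hphi]
      ring
    | phi =>
      simp only [kpReductionVal, e2, waveMatrix_phi_apply, a5, mul_zero]
      rw [kpMatrix, LinearMap.zero_apply, map_zero]

end KPReduction

/-! ### The shift of the moments for the KP matrix -/

section KPShift

variable {K : Type*} [CommRing K]

theorem partialD_A_self (n : ℕ) : partialD (.A n, 0) (A n : MomentRing K) = 1 :=
  partialD_var_self _

theorem partialD_A_ne {n : ℕ} {l : MomentIdx} (h : .A n ≠ l) (j : ℕ) :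
    partialD (l, j) (A n : MomentRing K) = 0 :=
  partialD_var_ne h j

theorem partialD_succ_A (n : ℕ) (l : MomentIdx) (j : ℕ) :
    partialD (l, j + 1) (A n : MomentRing K) = 0 :=
  partialD_succ_var _ _ _

theorem partialD_smul_phi_self (c : K) :
    partialD (.phi, 0) (c • phi : MomentRing K) = algebraMap K _ c := by
  rw [partialD_smul, phi, partialD_var_self, Algebra.algebraMap_eq_smul_one]

theorem partialD_smul_phi_ne (c : K) {l : MomentIdx} (h : .phi ≠ l) (j : ℕ) :
    partialD (l, j) (c • phi : MomentRing K) = 0 := by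
  rw [partialD_smul, phi, partialD_var_ne h, smul_zero]

theorem partialD_succ_smul_phi (c : K) (l : MomentIdx) (j : ℕ) :
    partialD (l, j + 1) (c • phi : MomentRing K) = 0 := by
  rw [partialD_smul, phi, partialD_succ_var, smul_zero]

/-- The convolution is linear in the A's, so A_l enters only through its term k = l, which is
present when l ≤ m. -/
theorem partialD_bconv_A {q : ℕ → MomentRing K} {l : ℕ}
    (hq : ∀ k j, partialD (.A l, j) (q k) = 0) (m : ℕ) :
    partialD (.A l, 0) (bconv A q m) = m.choose l • q (m - l) := by
  simp only [derivation_bconv, hq]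
  rw [bconv, bconv]
  simp only [mul_zero, smul_zero, sum_const_zero, add_zero]
  rcases lt_or_ge m l with h | h
  · rw [Nat.choose_eq_zero_of_lt h, zero_smul]
    refine sum_eq_zero fun k hk => ?_
    rw [mem_range] at hk
    rw [partialD_A_ne (fun h' => by injection h'; omega), zero_mul, smul_zero]
  · rw [sum_eq_single_of_mem l (mem_range.mpr (by omega)), partialD_A_self, one_mul]
    intro k _ hk
    rw [partialD_A_ne (fun h' => hk (by injection h')), zero_mul, smul_zero]

theorem partialD_succ_bconv_A {q : ℕ → MomentRing K} {l : ℕ}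
    (hq : ∀ k j, partialD (.A l, j) (q k) = 0) (m j : ℕ) :
    partialD (.A l, j + 1) (bconv A q m) = 0 := by
  simp only [derivation_bconv, hq, partialD_succ_A]
  simp [bconv]

theorem partialD_phi_bconv_A (q : ℕ → MomentRing K) (m j : ℕ) :
    partialD (.phi, j) (bconv A q m) = bconv A (fun k => partialD (.phi, j) (q k)) m := by
  simp only [derivation_bconv]
  simp only [partialD_A_ne (l := .phi) (by simp)]
  simp [bconv]

theorem bconv_A_zero_index {q : ℕ → MomentRing K} (hq : q 0 = 1) : bconv A q 0 = A 0 := by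
  rw [bconv_zero_index, hq, mul_one]

theorem bconv_sub_left {R : Type*} [CommRing R] (a a' b : ℕ → R) (n : ℕ) :
    bconv (fun k => a k - a' k) b n = bconv a b n - bconv a' b n := by
  simp only [bconv, sub_mul, smul_sub, sum_sub_distrib]

variable [Differential K]

theorem kpMatrix_phi_phi (v : MomentRing K) : kpMatrix .phi .phi v = 0 := rfl

theorem adjFrechet_bconv_A {q : ℕ → MomentRing K}
    (hq : ∀ l k j, partialD (.A l, j) (q k) = 0) (l m : ℕ) (F : MomentRing K) :
    adjFrechet (.A l) (bconv A q m) F = m.choose l • (q (m - l) * F) := by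
  rw [adjFrechet_order_zero (partialD_succ_bconv_A (hq l) m), partialD_bconv_A (hq l), mul_comm,
    smul_mul_assoc]

theorem adjFrechet_A_phi (l : ℕ) (F : MomentRing K) : adjFrechet (.A l) phi F = 0 :=
  adjFrechet_var_ne (by simp) F

theorem adjFrechet_phi_phi (F : MomentRing K) : adjFrechet .phi phi F = F :=
  adjFrechet_var_self _ F

theorem evolution_bconv_A (Z : MomentIdx → MomentRing K) (q : ℕ → MomentRing K) (n : ℕ) :
    evolution Z (bconv A q n) =
      bconv (fun k => Z (.A k)) q n + bconv A (fun k => evolution Z (q k)) n := by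
  rw [derivation_bconv]
  congr 1
  exact congrArg (fun a => bconv a q n) (funext fun k => evolution_var Z _)

theorem evolution_phi (Z : MomentIdx → MomentRing K) : evolution Z phi = Z .phi :=
  evolution_var Z _

theorem lowerAdj_smul {ι : Type} {i₀ : ι} {c : K} (hc : Differential.deriv c = 0)
    (a : ℕ → JetRing K i₀) (n : ℕ) (v : JetRing K i₀) :
    lowerAdj a n (c • v) = c • lowerAdj a n v := by
  simp only [lowerAdj, mul_smul_comm, neg_del_pow_smul hc, smul_sum]

theorem isUnit_kpShiftVal (c : K) : IsUnit (kpShiftVal c (.A 0)) := by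
  simpa [kpShiftVal, Q, A] using isUnit_var (K := K)

theorem kpShiftVal_A (c : K) (n : ℕ) :
    kpShiftVal c (.A n) = bconv A (fun k => Q k (c • phi)) n := rfl

theorem kpShiftVal_phi (c : K) : kpShiftVal c .phi = phi := rfl

theorem kpShift_eq (c : K) : kpShift c = diffHom (kpShiftVal c) (isUnit_kpShiftVal c) := rfl

theorem kpShift_A (c : K) (n : ℕ) : kpShift c (A n) = bconv A (fun k => Q k (c • phi)) n :=
  diffHom_var _ _ _

theorem kpShift_phi (c : K) : kpShift c (phi : MomentRing K) = phi :=
  diffHom_var _ _ _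

theorem kpShift_bconv (c : K) (a b : ℕ → MomentRing K) (n : ℕ) : kpShift c (bconv a b n) =
    bconv (fun k => kpShift c (a k)) (fun k => kpShift c (b k)) n := by
  simp only [bconv, map_sum, map_nsmul, map_mul]

/-- Conjugating the A-block by the convolution with Q(w) on the left and its adjoint on the right
replaces each A by its shifted value. The two halves of the entry transform separately. -/
theorem sum_kpMatrix_A_A (w F : MomentRing K) (n m : ℕ) :
    bconv (fun k => ∑ l ∈ range (m + 1), kpMatrix (.A k) (.A l)
        (m.choose l • (Q (m - l) w * F))) (fun k => Q k w) n =
      ∑ μ ∈ range (n + 1), n.choose μ • (bconv A (fun k => Q k w) (n + m - μ) * (del ^ μ) F) -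
      ∑ μ ∈ range (m + 1), m.choose μ • ((-del) ^ μ : Module.End ℤ (MomentRing K))
        (bconv A (fun k => Q k w) (n + m - μ) * F) := by
  simp only [map_nsmul, kpMatrix_A_A, smul_sub, sum_sub_distrib, bconv_sub_left]
  rw [sum_bconv_mul_del_pow, sum_neg_del_pow_bconv]
  rfl

/-- The A-block is `sum_kpMatrix_A_A`. The remaining A-A contributions are the φ-column applied to λ
`lowerAdj`, and λφ in the Q's moved by the φ-row; after convolution both are `lowerOp` of the
shifted moments on the same argument, with opposite signs. -/
theorem isHamiltonianMap_kpShift {c : K} (hc : Differential.deriv c = 0) :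
    IsHamiltonianMap (kpMatrix (K := K)) kpMatrix (kpShift c) := by
  set q : ℕ → MomentRing K := fun k => Q k (c • phi) with hq
  have hqA : ∀ l k j, partialD (.A l, j) (q k) = 0 := by
    intro l k j
    rw [hq, partialD_Q (d := 0) (map_zero _) (partialD_smul_phi_ne c (by simp) 0)
      (partialD_succ_smul_phi c _), zero_mul]
  have hqphi : ∀ m j, partialD (.phi, j) (bconv A q m) =
      algebraMap K _ c * lowerSeq (bconv A q) (j + 1) m := by
    intro m j
    have h : ∀ k, partialD (.phi, j) (q k) = algebraMap K _ c * lowerSeq q (j + 1) k := fun k =>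
      partialD_Q (by rw [totalD_algebraMap, hc, map_zero]) (partialD_smul_phi_self c)
        (partialD_succ_smul_phi c _) k j
    rw [partialD_phi_bconv_A, funext h, bconv_mul_right, bconv_lowerSeq_right]
  have hadj : ∀ m F, adjFrechet .phi (bconv A q m) F = c • lowerAdj (bconv A q) m F := by
    intro m F
    rw [adjFrechet_lowerSeq (hqphi m), ← Algebra.smul_def, lowerAdj_smul hc]
  have hev : ∀ (Z : MomentIdx → MomentRing K) n, evolution Z (bconv A q n) =
      bconv (fun k => Z (.A k)) q n + lowerOp (bconv A q) n (c • Z .phi) := by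
    intro Z n
    rw [evolution_bconv_A, ← bconv_lowerOp_right]
    congr 2
    ext k
    rw [hq, derivation_Q (evolution_totalD Z), evolution_smul, evolution_phi]
  have hsum : ∀ i m F, ∑ᶠ l, kpMatrix i l (adjFrechet l (bconv A q m) F) =
      ∑ l ∈ range (m + 1), kpMatrix i (.A l) (m.choose l • (q (m - l) * F)) +
        kpMatrix i .phi (c • lowerAdj (bconv A q) m F) := by
    intro i m F
    rw [finsum_momentIdx _ (m + 1), hadj]
    · simp only [adjFrechet_bconv_A hqA]
    · intro l hl
      rw [adjFrechet_bconv_A hqA, Nat.choose_eq_zero_of_lt (by omega), zero_smul, map_zero]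
  have hsum' : ∀ i (F : MomentRing K), ∑ᶠ l, kpMatrix i l (adjFrechet l phi F) = kpMatrix i .phi F := by
    intro i F
    rw [finsum_momentIdx _ 0, sum_range_zero, zero_add, adjFrechet_phi_phi]
    intro l _
    rw [adjFrechet_A_phi, map_zero]
  have hinv : kpShift c (varInv : MomentRing K) = varInv :=
    diffHom_varInv _ _ (bconv_A_zero_index (q := q) (Q_zero _))
  have hphi : kpShift c (totalD phi : MomentRing K) = totalD phi := by
    rw [kpShift_eq, diffHom_totalD, ← kpShift_eq, kpShift_phi]
  have hA : ∀ n, kpShift c (A n) = bconv A q n := kpShift_A c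
  have hdel : ∀ j f, kpShift c ((del ^ j) f) = (del ^ j) (kpShift c f) := diffHom_del_pow _ _
  have hneg : ∀ j f, kpShift c (((-del) ^ j) f) = ((-del) ^ j) (kpShift c f) :=
    diffHom_neg_del_pow _ _
  have hop : ∀ n f, kpShift c (lowerOp A n f) = lowerOp (bconv A q) n (kpShift c f) := by
    intro n f
    simp only [lowerOp, lowerSeq, map_sum, map_mul, map_nsmul, hA, hdel]
  have hladj : ∀ n f, kpShift c (lowerAdj A n f) = lowerAdj (bconv A q) n (kpShift c f) := by
    intro n f
    simp only [lowerAdj, lowerSeq, map_sum, hneg, map_mul, map_nsmul, hA]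
  have hZphi : ∀ m (F : MomentRing K), ∑ l ∈ range (m + 1), kpMatrix .phi (.A l) (m.choose l • (q (m - l) * F)) =
      varInv * totalD phi * lowerAdj (bconv A q) m F := by
    intro m F
    rw [← sum_lowerAdj, mul_sum]
    exact sum_congr rfl fun l _ => by rw [map_nsmul, kpMatrix_phi_A, mul_smul_comm]
  have hval : ∀ n, kpShiftVal c (.A n) = bconv A q n := kpShiftVal_A c
  rw [kpShift_eq]
  apply isHamiltonianMap_diffHom
  intro i m v
  rw [← kpShift_eq]
  cases i with
  | A n =>
    cases m with
    | A m =>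
      -- The evolution of φ comes from the φ-row alone, since the φφ-entry is zero; no term
      -- quadratic in λ through φ arises.
      rw [hval, hval, hev, hsum, hZphi, kpMatrix_phi_phi, add_zero]
      simp only [hsum, kpMatrix_A_phi]
      simp only [← sub_eq_add_neg, bconv_sub_left]
      rw [sum_kpMatrix_A_A, bconv_lowerOp_left, mul_smul_comm, sub_add_cancel, kpMatrix_A_A,
        map_sub, map_sum, map_sum]
      simp only [map_nsmul, map_mul, hA, hdel, hneg]
      rfl
    | phi =>
      rw [hval, kpShiftVal_phi, hev, hsum', kpMatrix_phi_phi, smul_zero]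
      simp only [hsum', kpMatrix_A_phi, ← lowerOp_neg]
      rw [bconv_lowerOp_left, lowerOp_zero, add_zero, hop, map_neg, map_mul, map_mul, hinv, hphi]
  | phi =>
    cases m with
    | A m =>
      rw [hval, kpShiftVal_phi, evolution_phi, hsum, hZphi, kpMatrix_phi_A, map_mul,
        map_mul, hinv, hphi, hladj, kpMatrix_phi_phi, add_zero]
    | phi =>
      rw [kpShiftVal_phi, evolution_phi, hsum', kpMatrix_phi_phi, kpMatrix_phi_phi, map_zero]

/-- Shifting twice convolves A with Q(cφ) and then Q(dφ), because φ is fixed; associativity and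
`Q_add` combine these into Q((c+d)φ). -/
theorem kpShift_comp (c d : K) :
    (kpShift c).comp (kpShift d) = (kpShift (c + d) : MomentRing K →ₐ[K] MomentRing K) := by
  apply diffHom_ext
  · intro f
    rw [AlgHom.comp_apply, AlgHom.comp_apply, kpShift_eq, kpShift_eq, diffHom_totalD,
      diffHom_totalD]
  · intro f
    rw [kpShift_eq, diffHom_totalD]
  · intro i
    cases i with
    | A n =>
      change kpShift c (kpShift d (A n)) = kpShift (c + d) (A n)
      rw [kpShift_A, kpShift_A, kpShift_bconv, funext (kpShift_A c), add_smul]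
      have h : ∀ k, kpShift c (Q k (d • phi : MomentRing K)) = Q k (d • phi) := by
        intro k
        rw [kpShift_eq, diffHom_Q, ← kpShift_eq, map_smul, kpShift_phi]
      rw [funext h, funext fun k => Q_add k (c • phi : MomentRing K) (d • phi)]
      exact bconv_assoc _ _ _ _
    | phi =>
      change kpShift c (kpShift d phi) = kpShift (c + d) phi
      rw [kpShift_phi, kpShift_phi, kpShift_phi]

theorem kpShift_zero : (kpShift 0 : MomentRing K →ₐ[K] MomentRing K) = AlgHom.id K _ := by
  apply diffHom_ext
  · intro f
    rw [kpShift_eq, diffHom_totalD]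
  · intro f
    rfl
  · intro i
    cases i with
    | A n =>
      change kpShift 0 (A n) = A n
      rw [kpShift_A, zero_smul, bconv_Q_zero]
    | phi => exact kpShift_phi 0

theorem isHamiltonianAut_kpShift {c : K} (hc : Differential.deriv c = 0) :
    IsHamiltonianAut (kpMatrix (K := K)) (kpShift c) :=
  isHamiltonianAut_of_inverse (isHamiltonianMap_kpShift hc)
    (Ψ := kpShift (-c)) (by rw [kpShift_comp, add_neg_cancel, kpShift_zero])
    (by rw [kpShift_comp, neg_add_cancel, kpShift_zero])

theorem isUnit_kpReductionVal : IsUnit (kpReductionVal (K := K) (.A 0)) := by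
  simpa [kpReductionVal, Q, wh] using isUnit_var (K := K)

theorem kpReduction_eq : kpReduction (K := K) = diffHom kpReductionVal isUnit_kpReductionVal := rfl

theorem kpReduction_A (n : ℕ) : kpReduction (A n) = (wh * Q n wu : WaveRing K) :=
  diffHom_var _ _ _

theorem kpReduction_phi : kpReduction phi = (wphi : WaveRing K) :=
  diffHom_var _ _ _

theorem kpReduction_surjective : Function.Surjective (kpReduction (K := K)) :=
  surjective_of_var _ isUnit_kpReductionVal (by rw [kpReductionVal, Q_zero, mul_one])
    (by rw [kpReductionVal, Q_one]) rfl

theorem waveShift_wu (c : K) : waveShift c (wu : WaveRing K) = wu + c • wphi :=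
  diffHom_var _ _ _

theorem waveShift_wh (c : K) : waveShift c (wh : WaveRing K) = wh :=
  diffHom_var _ _ _

theorem waveShift_wphi (c : K) : waveShift c (wphi : WaveRing K) = wphi :=
  diffHom_var _ _ _

theorem kpReduction_kpShift_A (c : K) (n : ℕ) :
    kpReduction (kpShift c (A n)) = (wh * Q n (wu + c • wphi) : WaveRing K) := by
  have h : ∀ k, kpReduction (Q k (c • phi)) = (Q k (c • wphi) : WaveRing K) := by
    intro k
    rw [kpReduction_eq, diffHom_Q, ← kpReduction_eq, map_smul, kpReduction_phi]
  rw [kpShift_A, Q_add, ← bconv_mul_left]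
  simp only [bconv, map_sum, map_nsmul, map_mul, kpReduction_A, h]

theorem kpReduction_comp_kpShift (c : K) :
    (kpReduction (K := K)).comp (kpShift c) = (waveShift c).comp kpReduction := by
  apply diffHom_ext
  · intro f
    rw [AlgHom.comp_apply, AlgHom.comp_apply, kpShift_eq, kpReduction_eq, diffHom_totalD,
      diffHom_totalD]
  · intro f
    rw [AlgHom.comp_apply, AlgHom.comp_apply, waveShift_eq, kpReduction_eq, diffHom_totalD,
      diffHom_totalD]
  · intro i
    cases i with
    | A n =>
      change kpReduction (kpShift c (A n)) = waveShift c (kpReduction (A n))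
      rw [kpReduction_kpShift_A, kpReduction_A, map_mul, waveShift_wh, waveShift_eq, diffHom_Q,
        ← waveShift_eq, waveShift_wu]
    | phi =>
      change kpReduction (kpShift c phi) = waveShift c (kpReduction phi)
      rw [kpShift_phi, kpReduction_phi, waveShift_wphi]

/-- The case n = 1 already determines U, because Q_1(U) = U and h is a unit. -/
theorem kpReduction_kpShift_iff (c : K) (U : WaveRing K) :
    (∀ n, kpReduction (kpShift c (A n)) = wh * Q n U) ↔ U = wu + c • wphi := by
  constructor
  · intro h
    have h1 := h 1
    rw [kpReduction_kpShift_A, Q_one, Q_one] at h1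
    exact (isUnit_var.mul_left_cancel h1).symm
  · rintro rfl n
    exact kpReduction_kpShift_A c n

end KPShift

/-! ### Convolution with powers -/

section Powers

variable {R : Type*} [CommRing R]

theorem lowerSeq_one (a : ℕ → R) (n : ℕ) : lowerSeq a 1 n = n • a (n - 1) := by
  rw [lowerSeq, Nat.choose_one_right]

theorem bconv_smul_left (k : ℕ) (a b : ℕ → R) (n : ℕ) :
    bconv (fun l => k • a l) b n = k • bconv a b n := by
  simp only [nsmul_eq_mul, bconv_mul_left]

/-- Umbrally, with x^n for a_n, this says (x + w)^n (x + w)^m = (x + w)^{n+m}. -/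
theorem bconv_bconv_pow (w : R) (a : ℕ → R) (n m : ℕ) :
    bconv (fun k => bconv (fun l => a (k + l)) (fun j => w ^ j) m) (fun j => w ^ j) n =
      bconv a (fun j => w ^ j) (n + m) := by
  induction m generalizing a with
  | zero => simp only [bconv_zero_index, pow_zero, mul_one, add_zero]
  | succ m ih =>
    rw [← add_assoc, bconv_succ_index]
    simp only [bconv_succ_index, pow_succ', bconv_mul_right, bconv_add_left, bconv_mul_left]
    rw [ih, ← ih (fun k => a (k + 1))]
    simp only [add_assoc]

/-- The truncated subtraction matters only at k = 0, where the coefficient vanishes. -/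
theorem smul_sub_one_left (a : ℕ → R) (k l : ℕ) :
    k • a (k + l - 1) = k • a (k - 1 + l) := by
  cases k with
  | zero => simp
  | succ k => rw [show k + 1 + l - 1 = k + 1 - 1 + l by omega]

theorem smul_sub_one_right (a : ℕ → R) (k l : ℕ) :
    l • a (k + l - 1) = l • a (k + (l - 1)) := by
  cases l with
  | zero => simp
  | succ l => rfl

/-- Umbrally, the x-derivative of (x + w)^n, multiplied by (x + w)^m. -/
theorem bconv_bconv_smul_left (w : R) (a : ℕ → R) (n m : ℕ) :
    bconv (fun k => bconv (fun l => k • a (k + l - 1)) (fun j => w ^ j) m) (fun j => w ^ j) n =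
      n • bconv a (fun j => w ^ j) (n + m - 1) := by
  simp only [smul_sub_one_left, bconv_smul_left]
  simp only [← lowerSeq_one (fun k => bconv (fun l => a (k + l)) (fun j => w ^ j) m)]
  change bconv (lowerSeq _ 1) _ n = _
  rw [bconv_lowerSeq_left, lowerSeq_one, bconv_bconv_pow]

theorem bconv_bconv_smul_right (w : R) (a : ℕ → R) (n m : ℕ) :
    bconv (fun k => bconv (fun l => l • a (k + l - 1)) (fun j => w ^ j) m) (fun j => w ^ j) n =
      m • bconv a (fun j => w ^ j) (n + m - 1) := by
  have h : ∀ k, bconv (fun l => l • a (k + l - 1)) (fun j => w ^ j) m =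
      m • bconv (fun l => a (k + l)) (fun j => w ^ j) (m - 1) := by
    intro k
    simp only [smul_sub_one_right]
    simp only [← lowerSeq_one (fun l => a (k + l))]
    change bconv (lowerSeq _ 1) _ m = _
    rw [bconv_lowerSeq_left, lowerSeq_one]
  rw [funext h, bconv_smul_left, bconv_bconv_pow, ← smul_sub_one_right]

/-- Umbrally both sides are nm (x + w)^{n+m-2}: it does not matter which factor is differentiated in
x and which in w. This matches the w_x-terms of the two halves of the Benney entry. -/
theorem bconv_bconv_lowerSeq (w : R) (a : ℕ → R) (n m : ℕ) :
    bconv (fun k => bconv (fun l => k • a (k + l - 1)) (lowerSeq (fun j => w ^ j) 1) m)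
        (fun j => w ^ j) n =
      bconv (fun k => bconv (fun l => l • a (k + l - 1)) (fun j => w ^ j) m)
        (lowerSeq (fun j => w ^ j) 1) n := by
  simp only [bconv_lowerSeq_right, lowerSeq_one, bconv_bconv_smul_right]
  rw [bconv_smul_left, bconv_bconv_smul_left, smul_comm]
  cases n with
  | zero => simp only [zero_smul]
  | succ n =>
    cases m with
    | zero => simp only [zero_smul]
    | succ m => rw [show n + 1 + (m + 1 - 1) - 1 = n + 1 - 1 + (m + 1) - 1 by omega]

theorem derivation_pow {K : Type*} [CommRing K] {ι : Type} {i₀ : ι}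
    (D : Derivation ℤ (JetRing K i₀) (JetRing K i₀)) (w : JetRing K i₀) (n : ℕ) :
    D (w ^ n) = lowerSeq (fun k => w ^ k) 1 n * D w := by
  rw [Derivation.leibniz_pow, lowerSeq_one, smul_eq_mul, smul_mul_assoc]

end Powers

/-! ### Reduction and shift for the Benney matrix -/

section Benney

variable {K : Type*} [CommRing K]

theorem isUnit_benneyReductionVal : IsUnit (benneyReductionVal (K := K) (.A 0)) := by
  simpa [benneyReductionVal, wh] using isUnit_var (K := K)

theorem isUnit_benneyShiftVal (c : K) : IsUnit (benneyShiftVal c (.A 0)) := by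
  simpa [benneyShiftVal, A] using isUnit_var (K := K)

theorem benneyShiftVal_A (c : K) (n : ℕ) :
    benneyShiftVal c (.A n) = bconv A (fun k => (c • phi) ^ k) n := rfl

theorem benneyShiftVal_phi (c : K) : benneyShiftVal c .phi = phi := rfl

variable [Differential K]

theorem benneyMatrix_A_A (n m : ℕ) (v : MomentRing K) : benneyMatrix (.A n) (.A m) v =
    n • (A (n + m - 1) * totalD v) + m • totalD (A (n + m - 1) * v) := rfl

theorem benneyMatrix_phi_A (m : ℕ) (v : MomentRing K) :
    benneyMatrix .phi (.A m) v = varInv * totalD phi * (lowerSeq A 1 m * v) := by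
  rw [benneyMatrix, LinearMap.smul_apply, mulOp_apply, lowerSeq_one, smul_mul_assoc,
    mul_smul_comm]
  congr 1
  ring

theorem benneyMatrix_A_phi (n : ℕ) (v : MomentRing K) :
    benneyMatrix (.A n) .phi v = -(lowerSeq A 1 n * (varInv * totalD phi * v)) := by
  rw [benneyMatrix, LinearMap.neg_apply, LinearMap.smul_apply, mulOp_apply, lowerSeq_one,
    smul_mul_assoc]
  congr 2
  ring

theorem benneyMatrix_phi_phi (v : MomentRing K) : benneyMatrix .phi .phi v = 0 := rfl

theorem benneyReduction_eq :
    benneyReduction (K := K) = diffHom benneyReductionVal isUnit_benneyReductionVal := rfl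

theorem benneyReduction_A (n : ℕ) : benneyReduction (A n) = (wh * wu ^ n : WaveRing K) :=
  diffHom_var _ _ _

theorem benneyReduction_phi : benneyReduction phi = (wphi : WaveRing K) :=
  diffHom_var _ _ _

theorem benneyReduction_surjective : Function.Surjective (benneyReduction (K := K)) :=
  surjective_of_var _ isUnit_benneyReductionVal (by rw [benneyReductionVal, pow_zero, mul_one])
    (by rw [benneyReductionVal, pow_one]) rfl

theorem isHamiltonianMap_benneyReduction :
    IsHamiltonianMap (benneyMatrix (K := K)) waveMatrix benneyReduction := by
  set p : ℕ → WaveRing K := fun k => wu ^ k with hp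
  have wu_ne : ∀ l, l ≠ .u → ∀ j, partialD (l, j) (wu : WaveRing K) = 0 :=
    fun l hl j => partialD_var_ne hl.symm j
  have wu_self : partialD (.u, 0) (wu : WaveRing K) = 1 := partialD_var_self _
  have wu_succ : ∀ l j, partialD (l, j + 1) (wu : WaveRing K) = 0 := partialD_succ_var _
  have wh_u : ∀ j, partialD (.u, j) (wh : WaveRing K) = 0 := partialD_var_ne (by simp)
  have hu0 : ∀ l, l ≠ .u → ∀ n j, partialD (l, j) ((wu : WaveRing K) ^ n) = 0 := by
    intro l hl n j
    rw [derivation_pow, wu_ne l hl, mul_zero]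
  have a1 : ∀ n (F : WaveRing K), adjFrechet .u (wh * wu ^ n) F =
      F * (wh * lowerSeq p 1 n) := by
    intro n F
    rw [adjFrechet_order_zero, partialD_mul_of_right (wh_u 0), derivation_pow, wu_self, mul_one]
    intro j
    rw [partialD_mul_of_right (wh_u _), derivation_pow, wu_succ, mul_zero, mul_zero]
  have a2 : ∀ n (F : WaveRing K), adjFrechet .h (wh * wu ^ n) F = wu ^ n * F := by
    intro n F
    rw [adjFrechet_order_zero, partialD_mul_of_left (hu0 _ (by simp) _ _), wh, partialD_var_self,
      mul_one, mul_comm]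
    intro j
    rw [partialD_mul_of_left (hu0 _ (by simp) _ _), wh, partialD_succ_var, mul_zero]
  have a3 : ∀ n (F : WaveRing K), adjFrechet .phi (wh * wu ^ n) F = 0 := by
    intro n F
    apply adjFrechet_eq_zero
    intro j
    rw [partialD_mul_of_left (hu0 _ (by simp) _ _), wh, partialD_var_ne (by simp), mul_zero]
  have a4 : ∀ F : WaveRing K, adjFrechet .phi wphi F = F := adjFrechet_var_self _
  have a5 : ∀ F : WaveRing K, adjFrechet .u wphi F = 0 := adjFrechet_var_ne (by simp)
  have a6 : ∀ F : WaveRing K, adjFrechet .h wphi F = 0 := adjFrechet_var_ne (by simp)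
  have e1 : ∀ (Z : WaveIdx → WaveRing K) n, evolution Z (wh * wu ^ n) =
      wu ^ n * Z .h + wh * (lowerSeq p 1 n * Z .u) := by
    intro Z n
    rw [Derivation.leibniz, derivation_pow, hp, wu, wh, evolution_var, evolution_var, smul_eq_mul,
      smul_eq_mul, add_comm]
  have e2 : ∀ Z : WaveIdx → WaveRing K, evolution Z wphi = Z .phi := fun Z => evolution_var Z _
  have hA : ∀ n, benneyReduction (A n) = wh * p n := benneyReduction_A
  have hinv : benneyReduction (K := K) varInv = varInv :=
    diffHom_varInv _ _ (by simp [benneyReductionVal, wh])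
  have hD : ∀ f : MomentRing K, benneyReduction (totalD f) = totalD (benneyReduction f) :=
    diffHom_totalD _ _
  have hL : ∀ n, benneyReduction (lowerSeq A 1 n) = wh * lowerSeq p 1 n := by
    intro n
    rw [lowerSeq_one, map_nsmul, hA, ← mul_smul_comm, ← lowerSeq_one]
  rw [benneyReduction_eq]
  apply isHamiltonianMap_diffHom
  intro i m v
  rw [← benneyReduction_eq]
  cases i with
  | A n =>
    cases m with
    | A m =>
      simp only [benneyReductionVal, e1, waveMatrix_u_apply, waveMatrix_h_apply, a1, a2, a3,
        mul_zero, sub_zero]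
      rw [benneyMatrix_A_A, map_add, map_nsmul, map_nsmul, map_mul benneyReduction, hD, hD,
        map_mul benneyReduction, hA]
      generalize benneyReduction v = F
      rw [Derivation.leibniz totalD (wu ^ m) F, derivation_pow]
      have h1 : ∀ n m, n • p (n + m - 1) = wu ^ m * lowerSeq p 1 n := by
        intro n m
        rw [smul_sub_one_left, lowerSeq_one, mul_smul_comm, mul_comm]
        exact congrArg (n • ·) (pow_add wu (n - 1) m)
      have h2 : m • totalD (wh * p (n + m - 1) * F) =
          totalD (wu ^ n * (F * (wh * lowerSeq p 1 m))) := by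
        rw [← map_nsmul, ← smul_mul_assoc, ← mul_smul_comm, add_comm n m, h1]
        congr 1
        ring
      have h3 : n • (wh * p (n + m - 1) * totalD F) =
          wh * (wu ^ m * lowerSeq p 1 n) * totalD F := by
        rw [← smul_mul_assoc, ← mul_smul_comm, h1]
      rw [h2, h3, Derivation.leibniz totalD (wu ^ n), derivation_pow, ← hp]
      simp only [smul_eq_mul]
      ring
    | phi =>
      simp only [benneyReductionVal, e1, waveMatrix_u_apply, waveMatrix_h_apply, a4, a5, a6,
        map_zero, mul_zero, zero_add, zero_sub]
      rw [benneyMatrix_A_phi, map_neg, map_mul, map_mul, map_mul, hL, hinv, hD,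
        benneyReduction_phi]
      ring
  | phi =>
    cases m with
    | A m =>
      simp only [benneyReductionVal, e2, waveMatrix_phi_apply, a1]
      rw [benneyMatrix_phi_A, map_mul, map_mul, map_mul, hL, hinv, hD, benneyReduction_phi]
      ring
    | phi =>
      simp only [benneyReductionVal, e2, waveMatrix_phi_apply, a5, mul_zero]
      rw [benneyMatrix_phi_phi, map_zero]

theorem benneyShift_eq (c : K) :
    benneyShift c = diffHom (benneyShiftVal c) (isUnit_benneyShiftVal c) := rfl

theorem benneyShift_A (c : K) (n : ℕ) :
    benneyShift c (A n) = bconv A (fun k => (c • phi) ^ k) n :=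
  diffHom_var _ _ _

theorem benneyShift_phi (c : K) : benneyShift c (phi : MomentRing K) = phi :=
  diffHom_var _ _ _

/-- Where ∂ falls on `F` or the A's, the convolution formulas apply directly. The first half of the
entry also differentiates the inner powers of w, while the total derivative of the outer convolution
has a term with the outer powers differentiated; `bconv_bconv_lowerSeq` identifies the two. -/
theorem sum_benneyMatrix_A_A (w F : MomentRing K) (n m : ℕ) :
    bconv (fun k => ∑ l ∈ range (m + 1), benneyMatrix (.A k) (.A l)
        (m.choose l • (w ^ (m - l) * F))) (fun k => w ^ k) n =
      n • (bconv A (fun k => w ^ k) (n + m - 1) * totalD F) +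
        m • totalD (bconv A (fun k => w ^ k) (n + m - 1) * F) := by
  have h1 : ∀ k, ∑ l ∈ range (m + 1), benneyMatrix (.A k) (.A l) (m.choose l • (w ^ (m - l) * F)) =
      totalD F * bconv (fun l => k • A (k + l - 1)) (fun j => w ^ j) m +
      totalD w * F * bconv (fun l => k • A (k + l - 1)) (lowerSeq (fun j => w ^ j) 1) m +
      totalD (F * bconv (fun l => l • A (k + l - 1)) (fun j => w ^ j) m) := by
    intro k
    simp only [bconv, mul_sum, map_sum]
    rw [← sum_add_distrib, ← sum_add_distrib]
    refine sum_congr rfl fun l _ => ?_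
    rw [map_nsmul, benneyMatrix_A_A, mul_smul_comm, mul_smul_comm, mul_smul_comm, map_nsmul,
      ← smul_add, ← smul_add, Derivation.leibniz, derivation_pow]
    congr 2
    · simp only [smul_eq_mul, nsmul_eq_mul]
      ring
    · rw [← map_nsmul]
      congr 1
      simp only [nsmul_eq_mul]
      ring
  rw [funext h1, bconv_add_left, bconv_add_left, bconv_mul_left, bconv_mul_left,
    bconv_bconv_smul_left, bconv_bconv_lowerSeq]
  -- The second half of the entry has ∂ inside the convolution; pulling it out leaves exactly the
  -- w_x-term in which an outer power is differentiated.
  have h2 := derivation_bconv totalD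
    (fun k => F * bconv (fun l => l • A (k + l - 1)) (fun j => w ^ j) m) (fun j => w ^ j) n
  have h3 : ∀ k, totalD (w ^ k) = totalD w * lowerSeq (fun j => w ^ j) 1 k := fun k => by
    rw [derivation_pow, mul_comm]
  rw [funext h3, bconv_mul_right, bconv_mul_left, bconv_mul_left, bconv_bconv_smul_right] at h2
  rw [mul_smul_comm, map_nsmul, mul_comm F (bconv A _ _)] at h2
  rw [h2]
  simp only [nsmul_eq_mul]
  ring

/-- The cancellation is that of the KP shift, with multiplication by `lowerSeq _ 1` in place of
`lowerOp` and `lowerAdj`: powers of λφ involve no jets of φ. -/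
theorem isHamiltonianMap_benneyShift (c : K) :
    IsHamiltonianMap (benneyMatrix (K := K)) benneyMatrix (benneyShift c) := by
  set q : ℕ → MomentRing K := fun k => (c • phi) ^ k with hq
  have hqA : ∀ l k j, partialD (.A l, j) (q k) = 0 := by
    intro l k j
    rw [hq, derivation_pow, partialD_smul_phi_ne c (by simp), mul_zero]
  have hadj : ∀ m F, adjFrechet .phi (bconv A q m) F = c • (lowerSeq (bconv A q) 1 m * F) := by
    intro m F
    have h0 : ∀ k, partialD (.phi, 0) (q k) = algebraMap K _ c * lowerSeq q 1 k := by
      intro k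
      rw [hq, derivation_pow, partialD_smul_phi_self, mul_comm]
    have h1 : ∀ j k, partialD (.phi, j + 1) (q k) = 0 := by
      intro j k
      rw [hq, derivation_pow, partialD_succ_smul_phi, mul_zero]
    rw [adjFrechet_order_zero, partialD_phi_bconv_A, funext h0, bconv_mul_right,
      bconv_lowerSeq_right, Algebra.smul_def]
    · ring
    · intro j
      rw [partialD_phi_bconv_A, funext (h1 j)]
      simp [bconv]
  have hev : ∀ (Z : MomentIdx → MomentRing K) n, evolution Z (bconv A q n) =
      bconv (fun k => Z (.A k)) q n + lowerSeq (bconv A q) 1 n * (c • Z .phi) := by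
    intro Z n
    have h : ∀ k, evolution Z (q k) = (c • Z .phi) * lowerSeq q 1 k := by
      intro k
      rw [hq, derivation_pow, evolution_smul, evolution_phi, mul_comm]
    rw [evolution_bconv_A, funext h, bconv_mul_right, bconv_lowerSeq_right, mul_comm (c • Z .phi)]
  have hsum : ∀ i m F, ∑ᶠ l, benneyMatrix i l (adjFrechet l (bconv A q m) F) =
      ∑ l ∈ range (m + 1), benneyMatrix i (.A l) (m.choose l • (q (m - l) * F)) +
        benneyMatrix i .phi (c • (lowerSeq (bconv A q) 1 m * F)) := by
    intro i m F
    rw [finsum_momentIdx _ (m + 1), hadj]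
    · simp only [adjFrechet_bconv_A hqA]
    · intro l hl
      rw [adjFrechet_bconv_A hqA, Nat.choose_eq_zero_of_lt (by omega), zero_smul, map_zero]
  have hsum' : ∀ i (F : MomentRing K), ∑ᶠ l, benneyMatrix i l (adjFrechet l phi F) =
      benneyMatrix i .phi F := by
    intro i F
    rw [finsum_momentIdx _ 0, sum_range_zero, zero_add, adjFrechet_phi_phi]
    intro l _
    rw [adjFrechet_A_phi, map_zero]
  have hinv : benneyShift c (varInv : MomentRing K) = varInv :=
    diffHom_varInv _ _ (bconv_A_zero_index (q := q) (pow_zero _))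
  have hA : ∀ n, benneyShift c (A n) = bconv A q n := benneyShift_A c
  have hD : ∀ f : MomentRing K, benneyShift c (totalD f) = totalD (benneyShift c f) :=
    diffHom_totalD _ _
  have hL : ∀ n, benneyShift c (lowerSeq A 1 n) = lowerSeq (bconv A q) 1 n := by
    intro n
    rw [lowerSeq_one, map_nsmul, hA, lowerSeq_one]
  have hZphi : ∀ m (F : MomentRing K),
      ∑ l ∈ range (m + 1), benneyMatrix .phi (.A l) (m.choose l • (q (m - l) * F)) =
      varInv * totalD phi * (lowerSeq (bconv A q) 1 m * F) := by
    intro m F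
    rw [← bconv_lowerSeq_left, bconv, sum_mul, mul_sum]
    exact sum_congr rfl fun l _ => by
      rw [map_nsmul, benneyMatrix_phi_A, smul_mul_assoc, mul_smul_comm, mul_assoc (lowerSeq A 1 l)]
  have hval : ∀ n, benneyShiftVal c (.A n) = bconv A q n := benneyShiftVal_A c
  rw [benneyShift_eq]
  apply isHamiltonianMap_diffHom
  intro i m v
  rw [← benneyShift_eq]
  cases i with
  | A n =>
    cases m with
    | A m =>
      rw [hval, hval, hev, hsum, hZphi, benneyMatrix_phi_phi, add_zero]
      simp only [hsum, benneyMatrix_A_phi, ← sub_eq_add_neg, bconv_sub_left]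
      rw [sum_benneyMatrix_A_A]
      simp only [mul_comm (lowerSeq A 1 _)]
      rw [bconv_mul_left]
      change _ - _ * bconv (lowerSeq A 1) q n + _ = _
      rw [bconv_lowerSeq_left, benneyMatrix_A_A, map_add, map_nsmul, map_nsmul,
        map_mul (benneyShift c), hD, hD, map_mul (benneyShift c), hA, mul_smul_comm, mul_comm _ (lowerSeq (bconv A q) 1 n), sub_add_cancel]
    | phi =>
      rw [hval, benneyShiftVal_phi, hev, hsum', benneyMatrix_phi_phi, smul_zero, mul_zero,
        add_zero]
      simp only [hsum', benneyMatrix_A_phi, ← mul_neg]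
      simp only [mul_comm (lowerSeq A 1 _)]
      rw [bconv_mul_left]
      change _ * bconv (lowerSeq A 1) q n = _
      rw [bconv_lowerSeq_left, map_mul, hL, map_mul, map_neg, map_mul, hinv, hD, benneyShift_phi]
  | phi =>
    cases m with
    | A m =>
      rw [hval, benneyShiftVal_phi, evolution_phi, hsum, hZphi, benneyMatrix_phi_A, map_mul,
        map_mul, map_mul, hinv, hD, benneyShift_phi, hL, benneyMatrix_phi_phi, add_zero]
    | phi =>
      rw [benneyShiftVal_phi, evolution_phi, hsum', benneyMatrix_phi_phi, benneyMatrix_phi_phi,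
        map_zero]

theorem benneyShift_comp (c d : K) : (benneyShift c).comp (benneyShift d) =
    (benneyShift (c + d) : MomentRing K →ₐ[K] MomentRing K) := by
  apply diffHom_ext
  · intro f
    rw [AlgHom.comp_apply, AlgHom.comp_apply, benneyShift_eq, benneyShift_eq, diffHom_totalD,
      diffHom_totalD]
  · intro f
    rw [benneyShift_eq, diffHom_totalD]
  · intro i
    cases i with
    | A n =>
      change benneyShift c (benneyShift d (A n)) = benneyShift (c + d) (A n)
      have h : ∀ a : ℕ → MomentRing K, benneyShift c (bconv a (fun k => (d • phi) ^ k) n) =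
          bconv (fun k => benneyShift c (a k)) (fun k => (d • phi) ^ k) n := by
        intro a
        simp only [bconv, map_sum, map_nsmul, map_mul, map_pow, map_smul, benneyShift_phi]
      rw [benneyShift_A, benneyShift_A, h, funext (benneyShift_A c), add_smul,
        ← funext (bconv_pow (c • phi : MomentRing K) (d • phi))]
      exact bconv_assoc _ _ _ _
    | phi =>
      change benneyShift c (benneyShift d phi) = benneyShift (c + d) phi
      rw [benneyShift_phi, benneyShift_phi, benneyShift_phi]

theorem benneyShift_zero : (benneyShift 0 : MomentRing K →ₐ[K] MomentRing K) = AlgHom.id K _ := by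
  apply diffHom_ext
  · intro f
    rw [benneyShift_eq, diffHom_totalD]
  · intro f
    rfl
  · intro i
    cases i with
    | A n =>
      change benneyShift 0 (A n) = A n
      rw [benneyShift_A, zero_smul, bconv_single _ _ (pow_zero _) (fun k => zero_pow k.succ_ne_zero)]
    | phi => exact benneyShift_phi 0

theorem isHamiltonianAut_benneyShift (c : K) :
    IsHamiltonianAut (benneyMatrix (K := K)) (benneyShift c) :=
  isHamiltonianAut_of_inverse (isHamiltonianMap_benneyShift c)
    (Ψ := benneyShift (-c)) (by rw [benneyShift_comp, add_neg_cancel, benneyShift_zero])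
    (by rw [benneyShift_comp, neg_add_cancel, benneyShift_zero])

theorem benneyReduction_benneyShift_A (c : K) (n : ℕ) :
    benneyReduction (benneyShift c (A n)) = (wh * (wu + c • wphi) ^ n : WaveRing K) := by
  rw [benneyShift_A, ← bconv_pow, ← bconv_mul_left]
  simp only [bconv, map_sum, map_nsmul, map_mul, map_pow, map_smul, benneyReduction_A,
    benneyReduction_phi]

theorem benneyReduction_comp_benneyShift (c : K) :
    (benneyReduction (K := K)).comp (benneyShift c) = (waveShift c).comp benneyReduction := by
  apply diffHom_ext
  · intro f
    rw [AlgHom.comp_apply, AlgHom.comp_apply, benneyShift_eq, benneyReduction_eq, diffHom_totalD,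
      diffHom_totalD]
  · intro f
    rw [AlgHom.comp_apply, AlgHom.comp_apply, waveShift_eq, benneyReduction_eq, diffHom_totalD,
      diffHom_totalD]
  · intro i
    cases i with
    | A n =>
      change benneyReduction (benneyShift c (A n)) = waveShift c (benneyReduction (A n))
      rw [benneyReduction_benneyShift_A, benneyReduction_A, map_mul, waveShift_wh, map_pow,
        waveShift_wu]
    | phi =>
      change benneyReduction (benneyShift c phi) = waveShift c (benneyReduction phi)
      rw [benneyShift_phi, benneyReduction_phi, waveShift_wphi]

theorem benneyReduction_benneyShift_iff (c : K) (U : WaveRing K) :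
    (∀ n, benneyReduction (benneyShift c (A n)) = wh * U ^ n) ↔ U = wu + c • wphi := by
  constructor
  · intro h
    have h1 := h 1
    rw [benneyReduction_benneyShift_A, pow_one, pow_one] at h1
    exact (isUnit_var.mul_left_cancel h1).symm
  · rintro rfl n
    exact benneyReduction_benneyShift_A c n

end Benney

/-! ### The Casimirs A_0 and A_0 φ² -/

section Casimirs

variable {K : Type*} [CommRing K] [Differential K]

theorem isCasimir_of_hamRHS {ι : Type} {i₀ : ι} {B : ι → ι → Module.End ℤ (JetRing K i₀)}
    {H : JetRing K i₀} (h : ∀ i, hamRHS B H i = 0) : IsCasimir B H := by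
  rw [IsCasimir, hamField, show hamRHS B H = 0 from funext h, evolution_zero]

theorem varDeriv_add {ι : Type} {i₀ : ι} (l : ι) (f g : JetRing K i₀) :
    varDeriv l (f + g) = varDeriv l f + varDeriv l g := by
  rw [varDeriv, varDeriv, varDeriv, ← finsum_add_distrib ((varDeriv_support_finite f).1 l)
    ((varDeriv_support_finite g).1 l)]
  simp only [map_add]

theorem varDeriv_order_zero {ι : Type} {i₀ l : ι} {H : JetRing K i₀}
    (h : ∀ j, partialD (l, j + 1) H = 0) : varDeriv l H = partialD (l, 0) H := by
  rw [← adjFrechet_one, adjFrechet_order_zero h, one_mul]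

theorem varDeriv_var_ne {ι : Type} {i₀ i l : ι} (h : i ≠ l) :
    varDeriv l (var i : JetRing K i₀) = 0 := by
  rw [varDeriv_order_zero (partialD_succ_var i l), partialD_var_ne h]

theorem varDeriv_var_self {ι : Type} {i₀ : ι} (i : ι) :
    varDeriv i (var i : JetRing K i₀) = 1 := by
  rw [varDeriv_order_zero (partialD_succ_var i i), partialD_var_self]

theorem varDeriv_A_zero_mul_phi_sq (l : MomentIdx) :
    varDeriv l (A 0 * phi ^ 2 : MomentRing K) =
      phi ^ 2 * partialD (l, 0) (A 0) + 2 * A 0 * phi * partialD (l, 0) phi := by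
  have h : ∀ j, partialD (l, j) (A 0 * phi ^ 2 : MomentRing K) =
      phi ^ 2 * partialD (l, j) (A 0) + 2 * A 0 * phi * partialD (l, j) phi := by
    intro j
    rw [sq, Derivation.leibniz, Derivation.leibniz]
    simp only [smul_eq_mul]
    ring
  rw [varDeriv_order_zero, h]
  intro j
  rw [h, A, phi, partialD_succ_var, partialD_succ_var, mul_zero, mul_zero, add_zero]

theorem isCasimir_A_zero {B : MomentIdx → MomentIdx → Module.End ℤ (MomentRing K)}
    (h : ∀ i, B i (.A 0) 1 = 0) : IsCasimir B (A 0) := by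
  refine isCasimir_of_hamRHS fun i => ?_
  have h0 : varDeriv (.A 0) (A 0 : MomentRing K) = 1 := varDeriv_var_self _
  have h1 : ∀ l, MomentIdx.A 0 ≠ l → varDeriv l (A 0 : MomentRing K) = 0 :=
    fun l hl => varDeriv_var_ne hl
  rw [hamRHS, finsum_momentIdx _ 1, sum_range_one, h0, h, h1 _ (by simp), map_zero, add_zero]
  intro l hl
  rw [h1 _ (fun h' => by injection h'; omega), map_zero]

/-- Only δ/δA_0 = φ² and δ/δφ = 2A_0φ are nonzero, so two columns of the matrix decide. -/
theorem isCasimir_A_zero_mul_phi_sq {B : MomentIdx → MomentIdx → Module.End ℤ (MomentRing K)}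
    (h : ∀ i, B i (.A 0) (phi ^ 2) + B i .phi (2 * A 0 * phi) = 0) :
    IsCasimir B (A 0 * phi ^ 2) := by
  refine isCasimir_of_hamRHS fun i => ?_
  have h0 : varDeriv (.A 0) (A 0 * phi ^ 2 : MomentRing K) = phi ^ 2 := by
    rw [varDeriv_A_zero_mul_phi_sq, partialD_A_self, phi, partialD_var_ne (by simp), mul_one,
      mul_zero, add_zero]
  have h1 : varDeriv .phi (A 0 * phi ^ 2 : MomentRing K) = 2 * A 0 * phi := by
    rw [varDeriv_A_zero_mul_phi_sq, partialD_A_ne (by simp), phi, partialD_var_self, mul_one,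
      mul_zero, zero_add]
  rw [hamRHS, finsum_momentIdx _ 1, sum_range_one, h0, h1, h]
  intro l hl
  rw [varDeriv_A_zero_mul_phi_sq, partialD_A_ne (fun h' => by injection h'; omega), phi,
    partialD_var_ne (by simp), mul_zero, mul_zero, add_zero, map_zero]

/-- For m = 0 the adjoint half is the single term A_n v, which cancels the term μ = 0 of the first
half; the rest has a factor ∂ on the right. -/
theorem kpMatrix_A_A_zero (n : ℕ) (v : MomentRing K) :
    kpMatrix (.A n) (.A 0) v = lowerOp A n (totalD v) := by
  rw [kpMatrix_A_A, sum_range_succ', zero_add, sum_range_one, Nat.choose_zero_right,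
    Nat.choose_zero_right, one_smul, one_smul, pow_zero, pow_zero, Module.End.one_apply,
    Module.End.one_apply, add_sub_cancel_right, lowerOp]
  refine sum_congr rfl fun s _ => ?_
  rw [lowerSeq, smul_mul_assoc, pow_succ]
  rfl

theorem kpMatrix_phi_A_zero (v : MomentRing K) : kpMatrix .phi (.A 0) v = 0 := by
  rw [kpMatrix_phi_A, lowerAdj, sum_range_zero, mul_zero]

/-- The argument of the φ-column becomes ∂(φ²), the same as that of the A_0-column, which is why A_0
φ² is a Casimir. -/
theorem varInv_mul_totalD_phi_mul :
    (varInv * totalD phi * (2 * A 0 * phi) : MomentRing K) = totalD (phi ^ 2) := by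
  have h : (A 0 * varInv : MomentRing K) = 1 := var_mul_varInv
  rw [sq, Derivation.leibniz, smul_eq_mul]
  linear_combination 2 * phi * totalD phi * h

theorem isCasimir_kpMatrix_A_zero : IsCasimir (kpMatrix (K := K)) (A 0) := by
  refine isCasimir_A_zero fun i => ?_
  cases i with
  | A n => rw [kpMatrix_A_A_zero, Derivation.map_one_eq_zero, lowerOp_zero]
  | phi => exact kpMatrix_phi_A_zero 1

theorem isCasimir_kpMatrix_A_zero_mul_phi_sq :
    IsCasimir (kpMatrix (K := K)) (A 0 * phi ^ 2) := by
  refine isCasimir_A_zero_mul_phi_sq fun i => ?_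
  cases i with
  | A n =>
    rw [kpMatrix_A_A_zero, kpMatrix_A_phi, varInv_mul_totalD_phi_mul, add_neg_cancel]
  | phi => rw [kpMatrix_phi_A_zero, kpMatrix_phi_phi, add_zero]

theorem benneyMatrix_A_A_zero (n : ℕ) (v : MomentRing K) :
    benneyMatrix (.A n) (.A 0) v = lowerSeq A 1 n * totalD v := by
  rw [benneyMatrix_A_A, zero_smul, add_zero, lowerSeq_one, smul_mul_assoc, add_zero]

theorem benneyMatrix_phi_A_zero (v : MomentRing K) : benneyMatrix .phi (.A 0) v = 0 := by
  rw [benneyMatrix_phi_A, lowerSeq_one, zero_smul, zero_mul, mul_zero]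

theorem isCasimir_benneyMatrix_A_zero : IsCasimir (benneyMatrix (K := K)) (A 0) := by
  refine isCasimir_A_zero fun i => ?_
  cases i with
  | A n => rw [benneyMatrix_A_A_zero, Derivation.map_one_eq_zero, mul_zero]
  | phi => exact benneyMatrix_phi_A_zero 1

theorem isCasimir_benneyMatrix_A_zero_mul_phi_sq :
    IsCasimir (benneyMatrix (K := K)) (A 0 * phi ^ 2) := by
  refine isCasimir_A_zero_mul_phi_sq fun i => ?_
  cases i with
  | A n =>
    rw [benneyMatrix_A_A_zero, benneyMatrix_A_phi, varInv_mul_totalD_phi_mul, add_neg_cancel]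
  | phi => rw [benneyMatrix_phi_A_zero, benneyMatrix_phi_phi, add_zero]

/-- `A_0 φ²` is not a multiple of `A_0` modulo total derivatives. -/
theorem A_zero_mul_phi_sq_ne [Nontrivial K] [Algebra ℚ K] (a : K) (g : MomentRing K) :
    A 0 * phi ^ 2 ≠ a • A 0 + totalD g := by
  intro h
  have hsmul : varDeriv .phi (a • A 0 : MomentRing K) = 0 := by
    rw [varDeriv_order_zero, partialD_smul, partialD_A_ne (by simp), smul_zero]
    intro j
    rw [partialD_smul, partialD_succ_A, smul_zero]
  have hadd : varDeriv .phi (a • A 0 + totalD g) = varDeriv .phi (a • A 0 : MomentRing K) := by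
    rw [varDeriv_add, varDeriv_totalD, add_zero]
  have h1 := congrArg (varDeriv .phi) h
  rw [hadd, hsmul, varDeriv_A_zero_mul_phi_sq, partialD_A_ne (by simp), phi, partialD_var_self,
    mul_one, mul_zero, zero_add] at h1
  -- After δ/δφ the equation reads 2A_0φ = 0; ∂/∂φ turns it into 2A_0 = 0, which is impossible
  -- because A_0 and 2 are units in a nonzero ring.
  have h2 := congrArg (partialD (.phi, 0)) h1
  rw [partialD_mul_of_right, partialD_var_self, mul_one, map_zero] at h2
  · have : Nontrivial (MomentRing K) := nontrivial_jetRing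
    have h3 : (A 0 : MomentRing K) * varInv = 1 := var_mul_varInv
    have h4 : (algebraMap K (MomentRing K)) (algebraMap ℚ K (1 / 2)) * 2 = 1 := by
      rw [← map_ofNat (algebraMap K (MomentRing K)) 2, ← map_ofNat (algebraMap ℚ K) 2, ← map_mul,
        ← map_mul, one_div, inv_mul_cancel₀ two_ne_zero, map_one, map_one]
    refine one_ne_zero (α := MomentRing K) ?_
    rw [← h4, ← mul_one (_ * _), ← h3, mul_assoc, ← mul_assoc 2, h2, zero_mul, mul_zero]
  · rw [Derivation.leibniz, partialD_A_ne (by simp), smul_zero, zero_add,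
      ← map_ofNat (algebraMap K (MomentRing K)) 2, partialD_algebraMap, smul_zero]

end Casimirs

end

end KPExt

open KPExt in
theorem proposition17p44 {K : Type*} [CommRing K] [Nontrivial K] [Algebra ℚ K] [Differential K]
    (c : K) (hc : Differential.deriv c = 0) :
    -- the extended KP matrix
    (IsHamiltonianAut (kpMatrix (K := K)) (kpShift c) ∧
      (IsCasimir (kpMatrix (K := K)) (A 0) ∧ IsCasimir (kpMatrix (K := K)) (A 0 * phi ^ 2) ∧
        ∀ (a : K) (g : MomentRing K), A 0 * phi ^ 2 ≠ a • A 0 + totalD g) ∧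
      ((IsHamiltonianMap (kpMatrix (K := K)) waveMatrix kpReduction ∧
          Function.Surjective (kpReduction (K := K)) ∧
          IsHamiltonianAut (waveMatrix (K := K)) (waveShift c)) ∧
        kpReduction.comp (kpShift c) = (waveShift c).comp kpReduction ∧
        ∀ U : WaveRing K, (∀ n, kpReduction (kpShift c (A n)) = wh * Q n U) ↔
          U = wu + c • wphi)) ∧
    -- the extended Benney matrix
    (IsHamiltonianAut (benneyMatrix (K := K)) (benneyShift c) ∧
      (IsCasimir (benneyMatrix (K := K)) (A 0) ∧
        IsCasimir (benneyMatrix (K := K)) (A 0 * phi ^ 2) ∧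
        ∀ (a : K) (g : MomentRing K), A 0 * phi ^ 2 ≠ a • A 0 + totalD g) ∧
      ((IsHamiltonianMap (benneyMatrix (K := K)) waveMatrix benneyReduction ∧
          Function.Surjective (benneyReduction (K := K)) ∧
          IsHamiltonianAut (waveMatrix (K := K)) (waveShift c)) ∧
        benneyReduction.comp (benneyShift c) = (waveShift c).comp benneyReduction ∧
        ∀ U : WaveRing K, (∀ n, benneyReduction (benneyShift c (A n)) = wh * U ^ n) ↔
          U = wu + c • wphi)) :=
  ⟨⟨isHamiltonianAut_kpShift hc,
      ⟨isCasimir_kpMatrix_A_zero, isCasimir_kpMatrix_A_zero_mul_phi_sq, A_zero_mul_phi_sq_ne⟩,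
      ⟨isHamiltonianMap_kpReduction, kpReduction_surjective, isHamiltonianAut_waveShift c⟩,
      kpReduction_comp_kpShift c, kpReduction_kpShift_iff c⟩,
    ⟨isHamiltonianAut_benneyShift c,
      ⟨isCasimir_benneyMatrix_A_zero, isCasimir_benneyMatrix_A_zero_mul_phi_sq,
        A_zero_mul_phi_sq_ne⟩,
      ⟨isHamiltonianMap_benneyReduction, benneyReduction_surjective, isHamiltonianAut_waveShift c⟩,
      benneyReduction_comp_benneyShift c, benneyReduction_benneyShift_iff c⟩⟩
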